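/- **Theorem 3.2 (Carboni–Magid–Janelidze Galois correspondence).** Let $\mathcal A$ and $\mathcal X$ be categories with pullbacks and let $S\dashv C$ be an adjunction with $S:\mathcal A\to\mathcal X$ and unit $\eta$. For $X\in\mathcal A$ let $S_X\dashv C_X$ be the induced adjunction between $\mathcal A_{/X}$ and $\mathcal X_{/S(X)}$, where $S_X(a)=S(a)$ and $C_X(e)$ is the pullback of $C(e)$ along $\eta_X:X\to CS(X)$. Let $f:X\to Y$ be a morphism of $\mathcal A$, let $f^*:\mathcal A_{/Y}\to\mathcal A_{/X}$ be base change and $f_!$ its left adjoint. An object $a\in\mathcal A_{/Y}$ is *split by $f$* if the unit $f^*a\to C_XS_X(f^*a)$ of $S_X\dashv C_X$ is an isomorphism; $\mathrm{Split}_Y(f)$ is the full subcategory of $\mathcal A_{/Y}$ on these objects. Suppose that $f$ is *of relative Galois descent*: (1) $f^*$ is monadic; (2) the counit $S_XC_X\to\mathrm{id}$ is an isomorphism; (3) $f_!C_X(e)$ is split by $f$ for every $e\in\mathcal X_{/S(X)}$. Then $f\in\mathrm{Split}_Y(f)$, and the image under $S$ of the kernel pair groupoid $X\times_YX\rightrightarrows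 X$ is an internal groupoid $G=\mathrm{Gal}[f]$ in $\mathcal X$, with $G_0=S(X)$ and $G_1=S(X\times_YX)$. A *split quotient* of $f$ is an isomorphism class of regular epimorphisms $X\to P$ (over $Y$) in the category $\mathrm{Split}_Y(f)$; write $P\le P'$ if $X\to P$ factors through $X\to P'$. A *subgroupoid* of $G$ is a subobject $G_1'\hookrightarrow G_1$ that contains the identities and is closed under composition and inverses; subgroupoids are ordered by inclusion. Let $\mathcal X^G$ be the category of actions of $G$ in $\mathcal X$, and let $\tilde G\in\mathcal X^G$ be the canonical action of $G$ on itself, that is, $G_1$ over $G_0$ via the target map. A subgroupoid $G'$ is *effective* if the associated equivalence relation $G_1\times_{G_0}G_1'\rightrightarrows\tilde G$, $(g,g')\mapsto g$ and $(g,g')\mapsto g\circ g'$, has a coequaliser in $\mathcal X^G$ and is the kernel pair of it. Then there is an isomorphism of ordered sets between the opposite of the ordered set of split quotients of $f$ and the ordered set of effective subgroupoids of $\mathrm{Gal}[f]$, that is, an order anti-isomorphism, with the following two properties. * It sends a split quotient $h:X\to P$ to $\mathrm{Gal}[X\to P]$: the morphism $h$ is split by itself, so that $\mathrm{Gal}[X\to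 P]$, the image under $S$ of the kernel pair groupoid $X\times_PX\rightrightarrows X$, is an internal groupoid in $\mathcal X$ with object of objects $S(X)$; the induced morphism $S(X\times_PX)\to S(X\times_YX)$ is a monomorphism and a morphism of groupoids that is the identity on objects; and it represents the subgroupoid associated with $P$. * Its inverse sends an effective subgroupoid $G'$ to $X/G'$, the coequaliser in $\mathrm{Split}_Y(f)$ of the pair $X\times_{S(X)}G_1'\rightrightarrows X$ that consists of the projection and of the restriction of the action $\mu:X\times_{S(X)}G_1\cong X\times_YX\to X$ of $G$ on $X$. Here $X\times_{S(X)}G_1'$ is $f_!C_X(G_1'\to S(X))$, formed with the target map, the isomorphism $X\times_YX\cong X\times_{S(X)}G_1$ is the unit of $S_X\dashv C_X$ at $f^*f$, and $X\times_YX\to X$ is the counit of $f_!\dashv f^*$ at $f$. -/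

import Mathlib

open CategoryTheory CategoryTheory.Limits

universe v₁ v₂ u₁ u₂

namespace GaloisCorr

noncomputable section

/-! ### Internal groupoids and their actions -/

/-- An internal groupoid with object of objects `G₀` in a category with pullbacks.
An arrow `a` goes from `a ≫ src` to `a ≫ tgt`, and `comp` composes in diagrammatic order: it sends
`(a, b)` with `a ≫ tgt = b ≫ src` to "first `a`, then `b`".
Associativity is written with generalized elements. -/
structure InternalGroupoid {C : Type u₂} [Category.{v₂} C] [HasPullbacks C] (G₀ : C) where
  arr : C
  src : arr ⟶ G₀
  tgt : arr ⟶ G₀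
  one : G₀ ⟶ arr
  inv : arr ⟶ arr
  comp : pullback tgt src ⟶ arr
  one_src : one ≫ src = 𝟙 G₀
  one_tgt : one ≫ tgt = 𝟙 G₀
  inv_src : inv ≫ src = tgt
  inv_tgt : inv ≫ tgt = src
  comp_src : comp ≫ src = pullback.fst tgt src ≫ src
  comp_tgt : comp ≫ tgt = pullback.snd tgt src ≫ tgt
  one_comp : ∀ h : (src ≫ one) ≫ tgt = 𝟙 arr ≫ src,
    pullback.lift (src ≫ one) (𝟙 arr) h ≫ comp = 𝟙 arr
  comp_one : ∀ h : 𝟙 arr ≫ tgt = (tgt ≫ one) ≫ src,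
    pullback.lift (𝟙 arr) (tgt ≫ one) h ≫ comp = 𝟙 arr
  assoc : ∀ {T : C} (a b c : T ⟶ arr) (hab : a ≫ tgt = b ≫ src) (hbc : b ≫ tgt = c ≫ src)
    (h : (pullback.lift a b hab ≫ comp) ≫ tgt = c ≫ src)
    (h' : a ≫ tgt = (pullback.lift b c hbc ≫ comp) ≫ src),
    pullback.lift (pullback.lift a b hab ≫ comp) c h ≫ comp =
      pullback.lift a (pullback.lift b c hbc ≫ comp) h' ≫ comp
  inv_comp : ∀ h : inv ≫ tgt = 𝟙 arr ≫ src,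
    pullback.lift inv (𝟙 arr) h ≫ comp = tgt ≫ one
  comp_inv : ∀ h : 𝟙 arr ≫ tgt = inv ≫ src,
    pullback.lift (𝟙 arr) inv h ≫ comp = src ≫ one

section Groupoid

variable {C : Type u₂} [Category.{v₂} C] [HasPullbacks C] {G₀ : C}

attribute [local simp] pullback.lift_fst pullback.lift_snd pullback.lift_fst_assoc
  pullback.lift_snd_assoc

namespace InternalGroupoid

/-- Composition of generalized arrows: first `a`, then `b`. -/
def mul (G : InternalGroupoid G₀) {T : C} (a b : T ⟶ G.arr) (h : a ≫ G.tgt = b ≫ G.src) :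
    T ⟶ G.arr :=
  pullback.lift a b h ≫ G.comp

theorem mul_src (G : InternalGroupoid G₀) {T : C} (a b : T ⟶ G.arr)
    (h : a ≫ G.tgt = b ≫ G.src) : G.mul a b h ≫ G.src = a ≫ G.src := by
  simp [mul, G.comp_src]

theorem mul_tgt (G : InternalGroupoid G₀) {T : C} (a b : T ⟶ G.arr)
    (h : a ≫ G.tgt = b ≫ G.src) : G.mul a b h ≫ G.tgt = b ≫ G.tgt := by
  simp [mul, G.comp_tgt]

theorem comp_mul (G : InternalGroupoid G₀) {T T' : C} (t : T' ⟶ T) (a b : T ⟶ G.arr)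
    (h : a ≫ G.tgt = b ≫ G.src) :
    t ≫ G.mul a b h = G.mul (t ≫ a) (t ≫ b) (by simp [h]) := by
  rw [mul, mul, ← Category.assoc]
  congr 1
  ext <;> simp

theorem mul_congr (G : InternalGroupoid G₀) {T : C} {a a' b b' : T ⟶ G.arr}
    (ha : a = a') (hb : b = b') (h : a ≫ G.tgt = b ≫ G.src) :
    G.mul a b h = G.mul a' b' (by rw [← ha, ← hb, h]) := by
  subst ha hb; rfl

theorem mul_assoc (G : InternalGroupoid G₀) {T : C} (a b c : T ⟶ G.arr)
    (hab : a ≫ G.tgt = b ≫ G.src) (hbc : b ≫ G.tgt = c ≫ G.src) :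
    G.mul (G.mul a b hab) c (by rw [mul_tgt, hbc]) =
      G.mul a (G.mul b c hbc) (by rw [mul_src, hab]) :=
  G.assoc a b c hab hbc _ _

theorem mul_one (G : InternalGroupoid G₀) {T : C} (a : T ⟶ G.arr)
    (h : a ≫ G.tgt = ((a ≫ G.tgt) ≫ G.one) ≫ G.src) :
    G.mul a ((a ≫ G.tgt) ≫ G.one) h = a := by
  have := congrArg (a ≫ ·) (G.comp_one (by simp [G.one_src]))
  simp only [Category.comp_id] at this
  conv_rhs => rw [← this]
  rw [mul, ← Category.assoc]
  congr 1
  ext <;> simp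

/-- `i` is a morphism of internal groupoids `H ⟶ G` that is the identity on the common object of
objects (compatibility with inverses is automatic). -/
structure IsHom (H G : InternalGroupoid G₀) (i : H.arr ⟶ G.arr) : Prop where
  src : i ≫ G.src = H.src
  tgt : i ≫ G.tgt = H.tgt
  one : H.one ≫ i = G.one
  comp : ∀ {T : C} (a b : T ⟶ H.arr) (h : a ≫ H.tgt = b ≫ H.src)
    (h' : (a ≫ i) ≫ G.tgt = (b ≫ i) ≫ G.src), H.mul a b h ≫ i = G.mul (a ≫ i) (b ≫ i) h'

/-- An action of the internal groupoid `G` (an internal diagram on `G`): an object `proj` over `G₀`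
with `G` acting by `(g, x) ↦ g • x`, defined when `g ≫ src = x ≫ proj`. -/
structure Action (G : InternalGroupoid G₀) where
  obj : C
  proj : obj ⟶ G₀
  act : pullback G.src proj ⟶ obj
  act_proj : act ≫ proj = pullback.fst G.src proj ≫ G.tgt
  one_act : ∀ h : (proj ≫ G.one) ≫ G.src = 𝟙 obj ≫ proj,
    pullback.lift (proj ≫ G.one) (𝟙 obj) h ≫ act = 𝟙 obj
  mul_act : ∀ {T : C} (a b : T ⟶ G.arr) (x : T ⟶ obj) (hax : a ≫ G.src = x ≫ proj)
    (hab : a ≫ G.tgt = b ≫ G.src)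
    (h : G.mul a b hab ≫ G.src = x ≫ proj)
    (h' : b ≫ G.src = (pullback.lift a x hax ≫ act) ≫ proj),
    pullback.lift (G.mul a b hab) x h ≫ act =
      pullback.lift b (pullback.lift a x hax ≫ act) h' ≫ act

namespace Action

variable {G : InternalGroupoid G₀}

/-- A morphism of actions: a morphism over `G₀` that commutes with the actions. -/
@[ext]
structure Hom (P Q : Action G) where
  hom : P.obj ⟶ Q.obj
  w : hom ≫ Q.proj = P.proj
  equivariant : ∀ h : pullback.fst G.src P.proj ≫ G.src =
      (pullback.snd G.src P.proj ≫ hom) ≫ Q.proj,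
    P.act ≫ hom =
      pullback.lift (pullback.fst G.src P.proj) (pullback.snd G.src P.proj ≫ hom) h ≫ Q.act

theorem Hom.cond {P Q : Action G} (f : Hom P Q) : pullback.fst G.src P.proj ≫ G.src =
    (pullback.snd G.src P.proj ≫ f.hom) ≫ Q.proj := by
  rw [Category.assoc, f.w, pullback.condition]

/-- The category of actions of `G`. -/
instance : Category (Action G) where
  Hom P Q := Hom P Q
  id P :=
    { hom := 𝟙 _
      w := by simp
      equivariant := fun h => by
        rw [Category.comp_id]
        conv_lhs => rw [← Category.id_comp P.act]
        congr 1
        ext <;> simp }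
  comp {P Q R} f g :=
    { hom := f.hom ≫ g.hom
      w := by rw [Category.assoc, g.w, f.w]
      equivariant := fun h => by
        rw [← Category.assoc, f.equivariant f.cond, Category.assoc, g.equivariant g.cond,
          ← Category.assoc]
        congr 1
        ext <;> simp }
  id_comp f := Hom.ext (Category.id_comp _)
  comp_id f := Hom.ext (Category.comp_id _)
  assoc f g h := Hom.ext (Category.assoc _ _ _)

end Action

/-- The canonical action of `G` on itself: the object of arrows, lying over `G₀` through `tgt`,
with `G` acting by composition on the side of the target. -/
def regular (G : InternalGroupoid G₀) : Action G where
  obj := G.arr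
  proj := G.tgt
  act := G.mul (pullback.snd G.src G.tgt) (pullback.fst G.src G.tgt) pullback.condition.symm
  act_proj := G.mul_tgt _ _ _
  one_act h := by
    refine (G.comp_mul _ _ _ _).trans ((G.mul_congr ?_ ?_ _).trans
      (G.mul_one (𝟙 G.arr) (by simp [G.one_src])))
    · simp
    · simp
  mul_act a b x hax hab h h' := by
    refine (G.comp_mul _ _ _ _).trans (Eq.trans ?_ (G.comp_mul _ _ _ _).symm)
    refine (G.mul_congr (pullback.lift_snd _ _ _) (pullback.lift_fst _ _ _) _).trans ?_
    refine (G.mul_assoc x a b hax.symm hab).symm.trans ?_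
    refine G.mul_congr ?_ (pullback.lift_fst _ _ _).symm _
    refine Eq.trans ?_ (pullback.lift_snd _ _ _).symm
    refine Eq.trans ?_ (G.comp_mul _ _ _ _).symm
    exact G.mul_congr (pullback.lift_snd _ _ _).symm (pullback.lift_fst _ _ _).symm _

/-- For a subobject `H` of the object of arrows, the object `G₁ ×_{G₀} H` of pairs `(g, g')` with
`g ≫ src = g' ≫ tgt` as an action of `G`, acting on the first component. -/
def cosetRel (G : InternalGroupoid G₀) (H : Subobject G.arr) : Action G where
  obj := pullback G.src (H.arrow ≫ G.tgt)
  proj := pullback.fst G.src (H.arrow ≫ G.tgt) ≫ G.tgt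
  act := pullback.lift
    (G.mul (pullback.snd G.src (pullback.fst G.src (H.arrow ≫ G.tgt) ≫ G.tgt) ≫ pullback.fst _ _)
      (pullback.fst _ _) (by rw [Category.assoc, pullback.condition]))
    (pullback.snd _ _ ≫ pullback.snd _ _)
    (by rw [mul_src, Category.assoc, Category.assoc, pullback.condition])
  act_proj := by
    rw [← Category.assoc, pullback.lift_fst, mul_tgt]
  one_act h := by
    apply pullback.hom_ext
    · rw [Category.assoc, pullback.lift_fst, Category.id_comp]
      refine (G.comp_mul _ _ _ _).trans ((G.mul_congr ?_ ?_ _).trans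
        (G.mul_one (pullback.fst G.src (H.arrow ≫ G.tgt)) (by simp [G.one_src])))
      · simp
      · simp
    · simp
  mul_act a b x hax hab h h' := by
    have e : (x ≫ pullback.fst G.src (H.arrow ≫ G.tgt)) ≫ G.tgt = a ≫ G.src := by
      rw [Category.assoc, hax]
    apply pullback.hom_ext
    · refine (Category.assoc _ _ _).trans (Eq.trans ?_ (Category.assoc _ _ _).symm)
      rw [pullback.lift_fst]
      refine (G.comp_mul _ _ _ _).trans (Eq.trans ?_ (G.comp_mul _ _ _ _).symm)
      refine (G.mul_congr (a' := x ≫ pullback.fst G.src (H.arrow ≫ G.tgt)) (b' := G.mul a b hab)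
        (by simp) (by simp) _).trans ?_
      refine (G.mul_assoc _ a b e hab).symm.trans ?_
      refine G.mul_congr ?_ (pullback.lift_fst _ _ _).symm _
      rw [pullback.lift_snd_assoc, Category.assoc, pullback.lift_fst]
      refine Eq.trans ?_ (G.comp_mul _ _ _ _).symm
      exact G.mul_congr (by simp) (by simp) _
    · simp

/-- The first projection `(g, g') ↦ g` as a morphism of actions. -/
def cosetFst (G : InternalGroupoid G₀) (H : Subobject G.arr) : G.cosetRel H ⟶ G.regular where
  hom := pullback.fst G.src (H.arrow ≫ G.tgt)
  w := rfl
  equivariant h := by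
    refine (pullback.lift_fst _ _ _).trans ?_
    refine Eq.trans ?_ (G.comp_mul _ _ _ _).symm
    exact G.mul_congr (pullback.lift_snd _ _ _).symm (pullback.lift_fst _ _ _).symm _

/-- The composition `(g, g') ↦ g ∘ g'` (first `g'`, then `g`) as a morphism of actions. -/
def cosetMul (G : InternalGroupoid G₀) (H : Subobject G.arr) : G.cosetRel H ⟶ G.regular where
  hom := G.mul (pullback.snd G.src (H.arrow ≫ G.tgt) ≫ H.arrow) (pullback.fst _ _)
    ((Category.assoc _ _ _).trans pullback.condition.symm)
  w := G.mul_tgt _ _ _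
  equivariant h := by
    have e : (pullback.snd G.src (pullback.fst G.src (H.arrow ≫ G.tgt) ≫ G.tgt) ≫
        pullback.fst _ _) ≫ G.tgt = pullback.fst _ _ ≫ G.src := by
      rw [Category.assoc, pullback.condition]
    have e' : ((pullback.snd G.src (pullback.fst G.src (H.arrow ≫ G.tgt) ≫ G.tgt) ≫
        pullback.snd G.src (H.arrow ≫ G.tgt)) ≫ H.arrow) ≫ G.tgt =
        (pullback.snd G.src (pullback.fst G.src (H.arrow ≫ G.tgt) ≫ G.tgt) ≫
          pullback.fst _ _) ≫ G.src := by
      simp only [Category.assoc, pullback.condition]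
    refine (G.comp_mul _ _ _ _).trans (Eq.trans ?_ (G.comp_mul _ _ _ _).symm)
    refine (G.mul_congr (pullback.lift_snd_assoc _ _ _ _) (pullback.lift_fst _ _ _) _).trans ?_
    refine (G.mul_assoc _ _ _ e' e).symm.trans ?_
    refine G.mul_congr ?_ (pullback.lift_fst _ _ _).symm _
    refine Eq.trans ?_ (pullback.lift_snd _ _ _).symm
    refine Eq.trans ?_ (G.comp_mul _ _ _ _).symm
    exact G.mul_congr (Category.assoc _ _ _) rfl _

/-- A subobject of the object of arrows is a subgroupoid (with the same object of objects) when it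
contains the identities and is closed under composition and inverses. -/
structure IsSubgroupoid (G : InternalGroupoid G₀) (H : Subobject G.arr) : Prop where
  one : H.Factors G.one
  inv : H.Factors (H.arrow ≫ G.inv)
  mul : ∀ {T : C} (a b : T ⟶ G.arr) (h : a ≫ G.tgt = b ≫ G.src),
    H.Factors a → H.Factors b → H.Factors (G.mul a b h)

/-- `H` is effective: the associated relation `G₁ ×_{G₀} H ⇉ G₁` on the canonical action of `G` has
a coequaliser in the category of actions and is the kernel pair of it. -/
def IsEffective (G : InternalGroupoid G₀) (H : Subobject G.arr) : Prop :=
  ∃ (Q : Action G) (q : G.regular ⟶ Q) (w : G.cosetFst H ≫ q = G.cosetMul H ≫ q),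
    Nonempty (IsColimit (Cofork.ofπ q w)) ∧ IsKernelPair q (G.cosetFst H) (G.cosetMul H)

/-- The ordered set of effective subgroupoids, ordered by inclusion. -/
abbrev EffSub (G : InternalGroupoid G₀) : Type max u₂ v₂ :=
  {H : Subobject G.arr // G.IsSubgroupoid H ∧ G.IsEffective H}

end InternalGroupoid

end Groupoid

/-! ### Relative Galois descent -/

section Galois

attribute [local simp] pullback.lift_fst pullback.lift_snd pullback.lift_fst_assoc
  pullback.lift_snd_assoc

variable {A : Type u₁} [Category.{v₁} A]
variable {B : Type u₂} [Category.{v₂} B]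
variable {S : A ⥤ B} {C : B ⥤ A}

theorem unit_transpose (adj : S ⊣ C) {D : A} {E : B} (u : D ⟶ C.obj E) :
    adj.unit.app D ≫ C.map (S.map u ≫ adj.counit.app E) = u := by
  simp

theorem transpose_comp (adj : S ⊣ C) {D Z : A} {E : B} (u : D ⟶ C.obj E) (q : E ⟶ S.obj Z)
    (p : D ⟶ Z) (h : u ≫ C.map q = p ≫ adj.unit.app Z) :
    (S.map u ≫ adj.counit.app E) ≫ q = S.map p := by
  have h1 := congrArg (fun k => S.map k ≫ adj.counit.app (S.obj Z)) h
  simpa using h1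

variable [HasPullbacks A]

/-- The functor `S_X : A/X ⥤ B/S(X)`, sending `a` to `S(a)`. -/
abbrev sliceS (S : A ⥤ B) (X : A) : Over X ⥤ Over (S.obj X) := Over.post S

/-- The functor `C_X : B/S(X) ⥤ A/X`, sending `e : E ⟶ S(X)` to the pullback of `C(e)` along the
unit `X ⟶ C(S(X))`. -/
abbrev sliceC (adj : S ⊣ C) (X : A) : Over (S.obj X) ⥤ Over X :=
  Over.post C ⋙ Over.pullback (adj.unit.app X)

/-- The adjunction `S_X ⊣ C_X` between slices induced by `S ⊣ C`. -/
abbrev sliceAdj (adj : S ⊣ C) (X : A) : sliceS S X ⊣ sliceC adj X :=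
  Over.postAdjunctionLeft adj

/-- The object `a` over `Y` is split by `f : X ⟶ Y`: the unit of `S_X ⊣ C_X` is an isomorphism at
the base change `f^* a`. -/
def IsSplit (adj : S ⊣ C) {X Y : A} (f : X ⟶ Y) : ObjectProperty (Over Y) :=
  fun a => IsIso ((sliceAdj adj X).unit.app ((Over.pullback f).obj a))

/-- The category `Split_Y(f)`: the full subcategory of `A/Y` on the objects split by `f`. -/
abbrev Split (adj : S ⊣ C) {X Y : A} (f : X ⟶ Y) : Type max u₁ v₁ :=
  (IsSplit adj f).FullSubcategory

/-- The morphism `f` is of relative Galois descent for the adjunction `S ⊣ C`. -/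
structure IsRelativeGaloisDescent (adj : S ⊣ C) {X Y : A} (f : X ⟶ Y) : Prop where
  monadic : (Monad.comparison (Over.mapPullbackAdj f)).IsEquivalence
  counit_iso : IsIso (sliceAdj adj X).counit
  split : ∀ E : Over (S.obj X), IsSplit adj f ((Over.map f).obj ((sliceC adj X).obj E))

theorem sliceAdj_unit_app_left (adj : S ⊣ C) {X : A} (a : Over X) :
    ((sliceAdj adj X).unit.app a).left ≫
      pullback.fst (C.map (S.map a.hom)) (adj.unit.app X) = adj.unit.app a.left := by
  simp only [Functor.comp_obj, Functor.id_obj, Over.postAdjunctionLeft_unit_app_left]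
  erw [Category.assoc, Category.assoc, pullback.lift_fst, pullback.lift_fst,
    pullback.lift_fst_assoc, Category.id_comp]

theorem sliceAdj_counit_app_left (adj : S ⊣ C) {X : A} (e : Over (S.obj X)) :
    ((sliceAdj adj X).counit.app e).left =
      S.map (pullback.fst (C.map e.hom) (adj.unit.app X)) ≫ adj.counit.app e.left := by
  simp
  rfl

/-- If the unit of `S_X ⊣ C_X` is invertible at `a`, the naturality square of the unit of `S ⊣ C`
at `a` is a pullback. -/
theorem isPullback_of_isIso_unit (adj : S ⊣ C) {X : A} (a : Over X)
    (h : IsIso ((sliceAdj adj X).unit.app a)) :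
    IsPullback (adj.unit.app a.left) a.hom (C.map (S.map a.hom)) (adj.unit.app X) := by
  have : IsIso ((sliceAdj adj X).unit.app a).left :=
    inferInstanceAs (IsIso ((Over.forget X).map ((sliceAdj adj X).unit.app a)))
  exact IsPullback.of_iso_pullback ⟨adj.unit_naturality a.hom⟩
    (@asIso _ _ _ _ _ this) (sliceAdj_unit_app_left adj a)
    (Over.w ((sliceAdj adj X).unit.app a))

theorem isIso_of_isPullback (adj : S ⊣ C) {X D : A} {E : B} (hc : IsIso (sliceAdj adj X).counit)
    {u : D ⟶ C.obj E} {d : D ⟶ X} {e : E ⟶ S.obj X}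
    (h : IsPullback u d (C.map e) (adj.unit.app X)) :
    IsIso (S.map u ≫ adj.counit.app E) := by
  have h1 : IsIso ((sliceAdj adj X).counit.app (Over.mk e)).left :=
    inferInstanceAs (IsIso ((Over.forget _).map ((sliceAdj adj X).counit.app (Over.mk e))))
  rw [sliceAdj_counit_app_left] at h1
  have h2 : S.map u ≫ adj.counit.app E = S.map h.isoPullback.hom ≫
      S.map (pullback.fst (C.map e) (adj.unit.app X)) ≫ adj.counit.app E := by
    rw [← Functor.map_comp_assoc, h.isoPullback_hom_fst]
  rw [h2]
  exact IsIso.comp_isIso' inferInstance h1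

theorem isPullback_of_selfSplit (adj : S ⊣ C) {X P : A} (h : X ⟶ P)
    (hs : IsSplit adj h (Over.mk h)) :
    IsPullback (adj.unit.app (pullback h h)) (pullback.snd h h)
      (C.map (S.map (pullback.snd h h))) (adj.unit.app X) :=
  isPullback_of_isIso_unit adj _ hs

/-- A morphism of relative Galois descent is split by itself. -/
theorem IsRelativeGaloisDescent.selfSplit {adj : S ⊣ C} {X Y : A} {f : X ⟶ Y}
    (hf : IsRelativeGaloisDescent adj f) : IsSplit adj f (Over.mk f) := by
  have hi : IsIso ((sliceC adj X).obj (Over.mk (𝟙 (S.obj X)))).hom := by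
    change IsIso (pullback.snd (C.map (𝟙 (S.obj X))) (adj.unit.app X))
    infer_instance
  let i : (Over.map f).obj ((sliceC adj X).obj (Over.mk (𝟙 (S.obj X)))) ≅ Over.mk f :=
    Over.isoMk (@asIso _ _ _ _ _ hi) rfl
  have h := hf.split (Over.mk (𝟙 (S.obj X)))
  exact ((NatTrans.isIso_app_iff_of_iso _ ((Over.pullback f).mapIso i)).1 h)

variable [HasPullbacks B]

/-- `S` preserves the pullback of `c : Z₁ ⟶ X` and `b : Z₂ ⟶ X` when the naturality squares of the
unit at `c` and at a second morphism `a : Z₂ ⟶ X` are pullbacks. -/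
theorem preserves_pullback (adj : S ⊣ C) {X Z₁ Z₂ : A} (hc : IsIso (sliceAdj adj X).counit)
    (c : Z₁ ⟶ X) (b a : Z₂ ⟶ X)
    (h₁ : IsPullback (adj.unit.app Z₁) c (C.map (S.map c)) (adj.unit.app X))
    (h₂ : IsPullback (adj.unit.app Z₂) a (C.map (S.map a)) (adj.unit.app X)) :
    IsPullback (S.map (pullback.fst c b)) (S.map (pullback.snd c b)) (S.map c) (S.map b) ∧
    IsPullback (adj.unit.app (pullback c b)) (pullback.snd c b ≫ a)
      (C.map (S.map (pullback.snd c b ≫ a))) (adj.unit.app X) := by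
  have : PreservesLimits C := adj.rightAdjoint_preservesLimits
  let E := pullback (S.map c) (S.map b)
  let q₁ : E ⟶ S.obj Z₁ := pullback.fst _ _
  let q₂ : E ⟶ S.obj Z₂ := pullback.snd _ _
  have hE : IsPullback q₁ q₂ (S.map c) (S.map b) := IsPullback.of_hasPullback _ _
  have hCE : IsPullback (C.map q₁) (C.map q₂) (C.map (S.map c)) (C.map (S.map b)) := hE.map C
  have hD : IsPullback (pullback.fst c b) (pullback.snd c b) c b := IsPullback.of_hasPullback _ _
  have big : IsPullback (pullback.fst c b ≫ adj.unit.app Z₁) (pullback.snd c b)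
      (C.map (S.map c)) (b ≫ adj.unit.app X) := hD.paste_horiz h₁
  rw [← adj.unit_naturality b] at big
  let u : pullback c b ⟶ C.obj E :=
    hCE.lift (pullback.fst c b ≫ adj.unit.app Z₁) (pullback.snd c b ≫ adj.unit.app Z₂)
      (by rw [big.w, Category.assoc])
  have hu₁ : u ≫ C.map q₁ = pullback.fst c b ≫ adj.unit.app Z₁ := hCE.lift_fst _ _ _
  have hu₂ : u ≫ C.map q₂ = pullback.snd c b ≫ adj.unit.app Z₂ := hCE.lift_snd _ _ _
  have sq : IsPullback u (pullback.snd c b) (C.map q₂) (adj.unit.app Z₂) :=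
    IsPullback.of_right (by rw [hu₁]; exact big) hu₂ hCE
  have sq' : IsPullback u (pullback.snd c b ≫ a) (C.map (q₂ ≫ S.map a)) (adj.unit.app X) := by
    rw [Functor.map_comp]
    exact sq.paste_vert h₂
  have hi : IsIso (S.map u ≫ adj.counit.app E) := isIso_of_isPullback adj hc sq'
  have k₁ : (S.map u ≫ adj.counit.app E) ≫ q₁ = S.map (pullback.fst c b) :=
    transpose_comp adj _ _ _ hu₁
  have k₂ : (S.map u ≫ adj.counit.app E) ≫ q₂ = S.map (pullback.snd c b) :=
    transpose_comp adj _ _ _ hu₂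
  have hw : S.map (pullback.fst c b) ≫ S.map c = S.map (pullback.snd c b) ≫ S.map b := by
    rw [← Functor.map_comp, ← Functor.map_comp, pullback.condition]
  refine ⟨IsPullback.of_iso_pullback ⟨hw⟩ (asIso (S.map u ≫ adj.counit.app E)) k₁ k₂, ?_⟩
  have hη : adj.unit.app (pullback c b) ≫ C.map (S.map u ≫ adj.counit.app E) = u :=
    unit_transpose adj u
  refine IsPullback.of_iso sq' (Iso.refl _) (asIso (C.map (S.map u ≫ adj.counit.app E))).symm
    (Iso.refl _) (Iso.refl _) ?_ (by simp) ?_ (by simp)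
  · simp only [Iso.symm_hom, asIso_inv, Iso.refl_hom, Category.id_comp, IsIso.comp_inv_eq, hη]
  · simp only [Iso.symm_hom, asIso_inv, Iso.refl_hom, Category.comp_id, IsIso.eq_inv_comp]
    rw [← Functor.map_comp, ← Category.assoc, k₂, ← Functor.map_comp]

/-! ### Galois groupoids

The kernel pair of `h : X ⟶ P` is the internal groupoid `X ×_P X ⇉ X`, where `(x, y)` is an arrow
from `x` to `y`.  The Galois groupoid of `h` is its image under `S`. -/

/-- Composition `(x, y), (y, z) ↦ (x, z)` in the kernel pair groupoid of `h`. -/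
abbrev kerComp {X P : A} (h : X ⟶ P) {Z : A} (α β : Z ⟶ pullback h h)
    (w : α ≫ pullback.snd h h = β ≫ pullback.fst h h) : Z ⟶ pullback h h :=
  pullback.lift (α ≫ pullback.fst h h) (β ≫ pullback.snd h h)
    (by rw [Category.assoc, pullback.condition, reassoc_of% w, Category.assoc, pullback.condition])

/-- When `S_X C_X ≅ 1` and `h` is split by itself, `S` preserves the pullback
`(X ×_P X) ×_X (X ×_P X)` of composable pairs. -/
theorem gal_isPullback_two (adj : S ⊣ C) {X P : A} (h : X ⟶ P)
    (hc : IsIso (sliceAdj adj X).counit) (hs : IsSplit adj h (Over.mk h)) :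
    IsPullback (S.map (pullback.fst (pullback.snd h h) (pullback.fst h h)))
      (S.map (pullback.snd (pullback.snd h h) (pullback.fst h h)))
      (S.map (pullback.snd h h)) (S.map (pullback.fst h h)) :=
  (preserves_pullback adj hc (pullback.snd h h) (pullback.fst h h) (pullback.snd h h)
    (isPullback_of_selfSplit adj h hs) (isPullback_of_selfSplit adj h hs)).1

theorem gal_isPullback_three (adj : S ⊣ C) {X P : A} (h : X ⟶ P)
    (hc : IsIso (sliceAdj adj X).counit) (hs : IsSplit adj h (Over.mk h)) :
    let t := pullback.snd (pullback.snd h h) (pullback.fst h h) ≫ pullback.snd h h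
    IsPullback (S.map (pullback.fst t (pullback.fst h h)))
      (S.map (pullback.snd t (pullback.fst h h))) (S.map t) (S.map (pullback.fst h h)) :=
  (preserves_pullback adj hc _ (pullback.fst h h) (pullback.snd h h)
    (preserves_pullback adj hc (pullback.snd h h) (pullback.fst h h) (pullback.snd h h)
      (isPullback_of_selfSplit adj h hs) (isPullback_of_selfSplit adj h hs)).2
    (isPullback_of_selfSplit adj h hs)).1

/-- The composition of the Galois groupoid: the image under `S` of the composition of the kernel
pair groupoid, along `S((X ×_P X) ×_X (X ×_P X)) ≅ S(X ×_P X) ×_{S(X)} S(X ×_P X)`. -/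
def galComp (adj : S ⊣ C) {X P : A} (h : X ⟶ P)
    (hc : IsIso (sliceAdj adj X).counit) (hs : IsSplit adj h (Over.mk h)) :
    pullback (S.map (pullback.snd h h)) (S.map (pullback.fst h h)) ⟶ S.obj (pullback h h) :=
  (gal_isPullback_two adj h hc hs).isoPullback.inv ≫
    S.map (kerComp h (pullback.fst (pullback.snd h h) (pullback.fst h h))
      (pullback.snd (pullback.snd h h) (pullback.fst h h)) pullback.condition)

theorem galComp_spec (adj : S ⊣ C) {X P : A} (h : X ⟶ P)
    (hc : IsIso (sliceAdj adj X).counit) (hs : IsSplit adj h (Over.mk h)) {T : B} {Z : A}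
    (t : T ⟶ S.obj Z) (α β : Z ⟶ pullback h h)
    (w : α ≫ pullback.snd h h = β ≫ pullback.fst h h) {a b : T ⟶ S.obj (pullback h h)}
    (ha : a = t ≫ S.map α) (hb : b = t ≫ S.map β)
    (w' : a ≫ S.map (pullback.snd h h) = b ≫ S.map (pullback.fst h h)) :
    pullback.lift a b w' ≫ galComp adj h hc hs = t ≫ S.map (kerComp h α β w) := by
  subst ha hb
  have h1 : pullback.lift (t ≫ S.map α) (t ≫ S.map β) w' =
      (t ≫ S.map (pullback.lift α β w)) ≫ (gal_isPullback_two adj h hc hs).isoPullback.hom := by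
    apply pullback.hom_ext
    · rw [pullback.lift_fst, Category.assoc, IsPullback.isoPullback_hom_fst, Category.assoc,
        ← S.map_comp, pullback.lift_fst]
    · rw [pullback.lift_snd, Category.assoc, IsPullback.isoPullback_hom_snd, Category.assoc,
        ← S.map_comp, pullback.lift_snd]
  rw [h1, galComp, Category.assoc, Iso.hom_inv_id_assoc, Category.assoc, ← S.map_comp]
  congr 2
  apply pullback.hom_ext
  · rw [Category.assoc, pullback.lift_fst, pullback.lift_fst, pullback.lift_fst_assoc]
  · rw [Category.assoc, pullback.lift_snd, pullback.lift_snd, pullback.lift_snd_assoc]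

/-- A composable triple of generalized arrows comes from `S` of a composable triple. -/
theorem gal_exists_three (adj : S ⊣ C) {X P : A} (h : X ⟶ P)
    (hc : IsIso (sliceAdj adj X).counit) (hs : IsSplit adj h (Over.mk h)) {T : B}
    (a b c : T ⟶ S.obj (pullback h h))
    (w : a ≫ S.map (pullback.snd h h) = b ≫ S.map (pullback.fst h h))
    (w' : b ≫ S.map (pullback.snd h h) = c ≫ S.map (pullback.fst h h)) :
    ∃ (Z : A) (t : T ⟶ S.obj Z) (α β γ : Z ⟶ pullback h h),
      α ≫ pullback.snd h h = β ≫ pullback.fst h h ∧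
      β ≫ pullback.snd h h = γ ≫ pullback.fst h h ∧
      a = t ≫ S.map α ∧ b = t ≫ S.map β ∧ c = t ≫ S.map γ := by
  have h2 := gal_isPullback_two adj h hc hs
  have h3 := gal_isPullback_three adj h hc hs
  have e : h2.lift a b w ≫ S.map (pullback.snd (pullback.snd h h) (pullback.fst h h) ≫
      pullback.snd h h) = c ≫ S.map (pullback.fst h h) := by
    rw [S.map_comp, h2.lift_snd_assoc, w']
  obtain ⟨t, e₁, e₂⟩ : ∃ t, t ≫ S.map (pullback.fst _ _) = h2.lift a b w ∧
      t ≫ S.map (pullback.snd _ _) = c :=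
    ⟨h3.lift (h2.lift a b w) c e, h3.lift_fst _ _ _, h3.lift_snd _ _ _⟩
  refine ⟨_, t, pullback.fst _ _ ≫ pullback.fst _ _,
    pullback.fst _ _ ≫ pullback.snd _ _, pullback.snd _ _, ?_, ?_, ?_, ?_, e₂.symm⟩
  · rw [Category.assoc, Category.assoc, pullback.condition]
  · rw [Category.assoc, pullback.condition]
  · rw [S.map_comp, reassoc_of% e₁, h2.lift_fst]
  · rw [S.map_comp, reassoc_of% e₁, h2.lift_snd]

/-- The Galois groupoid `Gal[h]` of a morphism `h : X ⟶ P` that is split by itself: the internal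
groupoid `S(X ×_P X) ⇉ S(X)`, with the structure induced by that of the kernel pair of `h`. -/
def galGroupoid (adj : S ⊣ C) {X P : A} (h : X ⟶ P)
    (hc : IsIso (sliceAdj adj X).counit) (hs : IsSplit adj h (Over.mk h)) :
    InternalGroupoid (S.obj X) where
  arr := S.obj (pullback h h)
  src := S.map (pullback.fst h h)
  tgt := S.map (pullback.snd h h)
  one := S.map (pullback.diagonal h)
  inv := S.map (pullbackSymmetry h h).hom
  comp := galComp adj h hc hs
  one_src := by rw [← S.map_comp, pullback.diagonal_fst, S.map_id]
  one_tgt := by rw [← S.map_comp, pullback.diagonal_snd, S.map_id]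
  inv_src := by rw [← S.map_comp, pullbackSymmetry_hom_comp_fst]
  inv_tgt := by rw [← S.map_comp, pullbackSymmetry_hom_comp_snd]
  comp_src := by
    rw [galComp, Category.assoc, ← S.map_comp, pullback.lift_fst, S.map_comp,
      IsPullback.isoPullback_inv_fst_assoc]
  comp_tgt := by
    rw [galComp, Category.assoc, ← S.map_comp, pullback.lift_snd, S.map_comp,
      IsPullback.isoPullback_inv_snd_assoc]
  one_comp w := by
    rw [galComp_spec adj h hc hs (𝟙 _) (pullback.fst h h ≫ pullback.diagonal h) (𝟙 _)
      (by simp) (by simp) (by simp), Category.id_comp, ← S.map_id]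
    congr 1
    apply pullback.hom_ext <;> simp
  comp_one w := by
    rw [galComp_spec adj h hc hs (𝟙 _) (𝟙 _) (pullback.snd h h ≫ pullback.diagonal h)
      (by simp) (by simp) (by simp), Category.id_comp, ← S.map_id]
    congr 1
    apply pullback.hom_ext <;> simp
  assoc a b c hab hbc w w' := by
    obtain ⟨Z, t, α, β, γ, h₁, h₂, rfl, rfl, rfl⟩ := gal_exists_three adj h hc hs a b c hab hbc
    rw [galComp_spec adj h hc hs t (kerComp h α β h₁) γ (by simp [h₂])
        (galComp_spec adj h hc hs t α β h₁ rfl rfl _) rfl,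
      galComp_spec adj h hc hs t α (kerComp h β γ h₂) (by simp [h₁]) rfl
        (galComp_spec adj h hc hs t β γ h₂ rfl rfl _)]
    congr 2
    apply pullback.hom_ext <;> simp
  inv_comp w := by
    rw [galComp_spec adj h hc hs (𝟙 _) (pullbackSymmetry h h).hom (𝟙 _)
      (by simp) (by simp) (by simp), Category.id_comp, ← S.map_comp]
    congr 1
    apply pullback.hom_ext <;> simp
  comp_inv w := by
    rw [galComp_spec adj h hc hs (𝟙 _) (𝟙 _) (pullbackSymmetry h h).hom
      (by simp) (by simp) (by simp), Category.id_comp, ← S.map_comp]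
    congr 1
    apply pullback.hom_ext <;> simp

/-- The Galois groupoid `Gal[f]` of a morphism of relative Galois descent. -/
def IsRelativeGaloisDescent.gal {adj : S ⊣ C} {X Y : A} {f : X ⟶ Y}
    (hf : IsRelativeGaloisDescent adj f) : InternalGroupoid (S.obj X) :=
  galGroupoid adj f hf.counit_iso hf.selfSplit

/-- The morphism `S(X ×_P X) ⟶ S(X ×_Y X)` on objects of arrows of Galois groupoids induced by a
factorization `f = h ≫ p` through `h : X ⟶ P`. -/
def galIncl (S : A ⥤ B) {X P Y : A} (h : X ⟶ P) (p : P ⟶ Y) (f : X ⟶ Y) (w : h ≫ p = f) :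
    S.obj (pullback h h) ⟶ S.obj (pullback f f) :=
  S.map (pullback.lift (pullback.fst h h) (pullback.snd h h)
    (by rw [← w, pullback.condition_assoc]))

/-! ### Split quotients -/

/-- The object `f : X ⟶ Y` of `Split_Y(f)`. -/
def IsRelativeGaloisDescent.top {adj : S ⊣ C} {X Y : A} {f : X ⟶ Y}
    (hf : IsRelativeGaloisDescent adj f) : Split adj f :=
  ⟨Over.mk f, hf.selfSplit⟩

/-- The ordered set of quotients of `X` over `Y` in `Split_Y(f)`: isomorphism classes of regular
epimorphisms `X ⟶ P` in `Split_Y(f)`, with `P ≤ P'` when `X ⟶ P` factors through `X ⟶ P'`.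
A quotient object is a subobject in the opposite category. -/
abbrev SplitQuo {adj : S ⊣ C} {X Y : A} {f : X ⟶ Y} (hf : IsRelativeGaloisDescent adj f) :
    Type max u₁ v₁ :=
  {Q : Subobject (Opposite.op hf.top) // IsRegularEpi Q.arrow.unop}

namespace SplitQuo

variable {adj : S ⊣ C} {X Y : A} {f : X ⟶ Y} {hf : IsRelativeGaloisDescent adj f}

/-- The object of `Split_Y(f)` underlying a quotient. -/
def obj (Q : SplitQuo hf) : Split adj f := Opposite.unop (Q.1 : (Split adj f)ᵒᵖ)

/-- The quotient morphism in `Split_Y(f)`. -/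
def proj (Q : SplitQuo hf) : hf.top ⟶ Q.obj := Q.1.arrow.unop

/-- The quotient morphism `X ⟶ P` in `A`. -/
def map (Q : SplitQuo hf) : X ⟶ Q.obj.obj.left := Q.proj.hom.left

theorem map_comp (Q : SplitQuo hf) : Q.map ≫ Q.obj.obj.hom = f := Over.w Q.proj.hom

end SplitQuo

/-! ### The quotient of `X` by a subgroupoid -/

section Quotient

variable {adj : S ⊣ C} {X Y : A} {f : X ⟶ Y} (hf : IsRelativeGaloisDescent adj f)
  (H : Subobject hf.gal.arr)

/-- The object `X ×_{S(X)} H` of `Split_Y(f)`, i.e. `f_! C_X(H ⟶ S(X))`, where `H` lies over `S(X)`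
through `tgt`. -/
def quotRel : Split adj f :=
  ⟨(Over.map f).obj ((sliceC adj X).obj (Over.mk (H.arrow ≫ hf.gal.tgt))), hf.split _⟩

/-- The isomorphism `X ×_Y X ≅ X ×_{S(X)} S(X ×_Y X)` given by the unit of `S_X ⊣ C_X` at `f^* f`. -/
def torsorIso : (Over.pullback f).obj (Over.mk f) ≅
    (sliceC adj X).obj (Over.mk hf.gal.tgt) :=
  @asIso _ _ _ _ ((sliceAdj adj X).unit.app ((Over.pullback f).obj (Over.mk f))) hf.selfSplit

/-- The morphism `X ×_{S(X)} H ⟶ X ×_{S(X)} S(X ×_Y X) ≅ X ×_Y X` over `X`. -/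
def quotRelToKer : (sliceC adj X).obj (Over.mk (H.arrow ≫ hf.gal.tgt)) ⟶
    (Over.pullback f).obj (Over.mk f) :=
  (sliceC adj X).map (Over.homMk (U := Over.mk (H.arrow ≫ hf.gal.tgt))
    (V := Over.mk hf.gal.tgt) H.arrow rfl) ≫ (torsorIso hf).inv

/-- The restriction to `H` of the action `X ×_{S(X)} S(X ×_Y X) ≅ X ×_Y X ⟶ X` of `Gal[f]` on `X`,
which is the counit of `f_! ⊣ f^*` at `f`. -/
def quotAct : quotRel hf H ⟶ hf.top :=
  ObjectProperty.homMk ((Over.map f).map (quotRelToKer hf H) ≫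
    (Over.mapPullbackAdj f).counit.app (Over.mk f))

/-- The projection `X ×_{S(X)} H ⟶ X`. -/
def quotProj : quotRel hf H ⟶ hf.top :=
  ObjectProperty.homMk
    (Over.homMk ((sliceC adj X).obj (Over.mk (H.arrow ≫ hf.gal.tgt))).hom rfl)

/-- The quotient `P` of `X` is `X/H`: the morphism `X ⟶ P` is the coequaliser in `Split_Y(f)` of the
action and the projection `X ×_{S(X)} H ⇉ X`. -/
def IsQuotientBy (P : SplitQuo hf) : Prop :=
  ∃ w : quotAct hf H ≫ P.proj = quotProj hf H ≫ P.proj, Nonempty (IsColimit (Cofork.ofπ P.proj w))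

end Quotient

end Galois

end

end GaloisCorr

open GaloisCorr

/-!
# The Galois correspondence for split quotients

Fix `f : X ⟶ Y` of relative Galois descent, and call an object `d : D ⟶ X` of `A/X` *local* when the
unit of `S_X ⊣ C_X` is invertible at it.  As the counit is invertible, `S_X` is an equivalence from
the local objects to `B/S(X)`: a morphism over `X` into a local object is determined by its image
under `S`, and every morphism over `S(X)` arises in this way.  By definition `a` is split by
`f` when `f^* a` is local.

*The Galois theorem.*  By monadicity, `A/Y` is the category of algebras for the monad
`d ↦ f^* f_! d = D ×_Y X`, and `Split_Y(f)` is the full subcategory of algebras with local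
underlying object.  Since `f` is split, `S` sends `D ×_Y X = (X ×_Y X) ×_X D`, for `d` local, to
`S(X ×_Y X) ×_{S(X)} S(D)` (`isPullback_map_tensor`).  So an algebra structure on `d` is the same as
an action of `Gal[f]` on `S(D)`, and `Split_Y(f)` is equivalent to the category of actions
(`splitToAction_isEquivalence`).

*Effective subgroupoids.*  Under this equivalence `f` corresponds to the canonical action of
`Gal[f]` on itself, and for a subobject `H` of its arrows the pair `X ×_{S(X)} H ⇉ X` corresponds to
`G₁ ×_{G₀} H ⇉ G₁`.  So `H` is effective exactly when the pair `X ×_{S(X)} H ⇉ X` has a coequaliser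
in `Split_Y(f)` of which it is the kernel pair (`isEffective_iff`).

*Quotients.*  If `h : X ⟶ P` is a quotient with `P` split by `f`, then `X ×_P X` is local over `X`,
as the equaliser of two morphisms between the local objects `X ×_Y X` and `P ×_Y X` (`isSplit_self`).
Therefore `S(X ×_P X) ⟶ S(X ×_Y X)` is a monomorphism, and a morphism `(u, v) : Z ⟶ X ×_Y X` is sent
by `S` to an arrow in `S(X ×_P X)` exactly when `u ≫ h = v ≫ h` (`SplitQuo.factors_galMap_iff`).  On
the other hand, the morphisms `Z ⟶ X ×_{S(X)} H` are the pairs `(u, v)` sent by `S` to an arrow in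
`H` (`exists_hom_quotRel`).  Hence the kernel pair of `h` is `X ×_{S(X)} S(X ×_P X) ⇉ X`
(`SplitQuo.isKernelPair_proj`), of which the regular epimorphism `h` is the coequaliser, and `H` is
contained in `S(X ×_P X)` exactly when `h` coequalises `X ×_{S(X)} H ⇉ X`
(`SplitQuo.quot_condition_iff`).  The order anti-isomorphism is a formal consequence, because a
regular epimorphism and its kernel pair determine each other.
-/

namespace GaloisCorr

noncomputable section

/-! ### Objects with invertible unit -/

section Adjunction

variable {D : Type u₁} [Category.{v₁} D] {E : Type u₂} [Category.{v₂} E] {L : D ⥤ E} {R : E ⥤ D}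

theorem map_injective_of_isIso_unit (adj : L ⊣ R) {d e : D} (he : IsIso (adj.unit.app e))
    {u v : d ⟶ e} (h : L.map u = L.map v) : u = v := by
  rw [← cancel_mono (adj.unit.app e)]
  exact (adj.unit_naturality u).symm.trans ((congrArg (fun k => adj.unit.app d ≫ R.map k) h).trans
    (adj.unit_naturality v))

theorem exists_map_eq_of_isIso_unit (adj : L ⊣ R) {d e : D} (he : IsIso (adj.unit.app e))
    (g : L.obj d ⟶ L.obj e) : ∃ u : d ⟶ e, L.map u = g := by
  refine ⟨adj.unit.app d ≫ R.map g ≫ inv (adj.unit.app e), ?_⟩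
  have h : L.map (inv (adj.unit.app e)) = adj.counit.app (L.obj e) := by
    rw [Functor.map_inv, IsIso.inv_eq_of_hom_inv_id]
    simp
  rw [L.map_comp, L.map_comp, h]
  simp

/-- When the counit is invertible, the unit at `d` is invertible as soon as it has a retraction. -/
theorem isIso_unit_of_retraction (adj : L ⊣ R) (hc : IsIso adj.counit) {d : D}
    (r : R.obj (L.obj d) ⟶ d) (h : adj.unit.app d ≫ r = 𝟙 d) : IsIso (adj.unit.app d) := by
  have h1 : adj.unit.app (R.obj (L.obj d)) = R.map (L.map (adj.unit.app d)) := by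
    rw [← cancel_mono (R.map (adj.counit.app (L.obj d)))]
    refine (adj.right_triangle_components (L.obj d)).trans ?_
    refine ((congrArg R.map (adj.left_triangle_components d)).trans (R.map_id _)).symm.trans ?_
    exact R.map_comp _ _
  refine ⟨r, h, ?_⟩
  have h2 : r ≫ adj.unit.app d = adj.unit.app (R.obj (L.obj d)) ≫ R.map (L.map r) :=
    adj.unit_naturality r |>.symm
  rw [h2, h1, ← R.map_comp, ← L.map_comp, h]
  exact (congrArg R.map (L.map_id d)).trans (R.map_id _)

theorem isIso_unit_of_iso (adj : L ⊣ R) {d e : D} (i : d ≅ e) (h : IsIso (adj.unit.app d)) :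
    IsIso (adj.unit.app e) :=
  (NatTrans.isIso_app_iff_of_iso adj.unit i).1 h

theorem isIso_unit_obj (adj : L ⊣ R) (hc : IsIso adj.counit) (e : E) :
    IsIso (adj.unit.app (R.obj e)) :=
  isIso_unit_of_retraction adj hc (R.map (adj.counit.app e)) (adj.right_triangle_components e)

/-- Two morphisms from `R L d` to an object with invertible unit agree if they agree on `d`. -/
theorem hom_ext_unit (adj : L ⊣ R) (hc : IsIso adj.counit) {d e : D}
    (he : IsIso (adj.unit.app e)) {u v : R.obj (L.obj d) ⟶ e}
    (h : adj.unit.app d ≫ u = adj.unit.app d ≫ v) : u = v := by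
  have h1 : IsIso (L.map (adj.unit.app d)) := by
    have h2 : IsIso (L.map (adj.unit.app d) ≫ adj.counit.app (L.obj d)) :=
      (adj.left_triangle_components d).symm ▸ (inferInstance : IsIso (𝟙 (L.obj d)))
    exact IsIso.of_isIso_comp_right _ (adj.counit.app (L.obj d))
  refine map_injective_of_isIso_unit adj he ?_
  rw [← cancel_epi (L.map (adj.unit.app d)), ← L.map_comp, h, L.map_comp]

/-- `L` preserves monomorphisms between objects with invertible units. -/
theorem mono_map_of_isIso_unit (adj : L ⊣ R) (hc : IsIso adj.counit) {d e : D}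
    (hd : IsIso (adj.unit.app d)) (he : IsIso (adj.unit.app e)) (k : d ⟶ e) [Mono k] :
    Mono (L.map k) where
  right_cancellation {Z} u v h := by
    obtain ⟨u', hu⟩ := exists_map_eq_of_isIso_unit adj hd (adj.counit.app Z ≫ u)
    obtain ⟨v', hv⟩ := exists_map_eq_of_isIso_unit adj hd (adj.counit.app Z ≫ v)
    have h1 : u' = v' := by
      rw [← cancel_mono k]
      refine map_injective_of_isIso_unit adj he ?_
      rw [L.map_comp, L.map_comp, hu, hv, Category.assoc, Category.assoc, h]
    rw [← cancel_epi (adj.counit.app Z), ← hu, ← hv, h1]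

end Adjunction

section Local

variable {A : Type u₁} [Category.{v₁} A] {B : Type u₂} [Category.{v₂} B] {S : A ⥤ B} {C : B ⥤ A}
  [HasPullbacks A]

/-- An object over `X` is local when the unit of `S_X ⊣ C_X` is invertible at it. -/
abbrev IsLocal (adj : S ⊣ C) {X : A} (d : Over X) : Prop :=
  IsIso ((sliceAdj adj X).unit.app d)

variable {adj : S ⊣ C} {X : A}

theorem IsLocal.hom_ext {d e : Over X} (he : IsLocal adj e) {u v : d ⟶ e}
    (h : S.map u.left = S.map v.left) : u = v :=
  map_injective_of_isIso_unit (sliceAdj adj X) he (Over.OverMorphism.ext h)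

theorem IsLocal.exists_hom {d e : Over X} (he : IsLocal adj e)
    (g : S.obj d.left ⟶ S.obj e.left) (w : g ≫ S.map e.hom = S.map d.hom) :
    ∃ u : d ⟶ e, S.map u.left = g := by
  obtain ⟨u, hu⟩ := exists_map_eq_of_isIso_unit (sliceAdj adj X) he
    (Over.homMk g w : (sliceS S X).obj d ⟶ (sliceS S X).obj e)
  exact ⟨u, congrArg CommaMorphism.left hu⟩

/-- The counit of `S_X ⊣ C_X` at `e : E ⟶ S(X)`, as an isomorphism `S(X ×_{CS(X)} C(E)) ≅ E`. -/
def counitLeftIso (hc : IsIso (sliceAdj adj X).counit) (e : Over (S.obj X)) :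
    S.obj ((sliceC adj X).obj e).left ≅ e.left :=
  (Over.forget _).mapIso (@asIso _ _ _ _ ((sliceAdj adj X).counit.app e) inferInstance)

theorem counitLeftIso_hom_comp (hc : IsIso (sliceAdj adj X).counit) (e : Over (S.obj X)) :
    (counitLeftIso hc e).hom ≫ e.hom = S.map ((sliceC adj X).obj e).hom :=
  Over.w ((sliceAdj adj X).counit.app e)

theorem counitLeftIso_naturality (hc : IsIso (sliceAdj adj X).counit) {e e' : Over (S.obj X)}
    (k : e ⟶ e') :
    S.map ((sliceC adj X).map k).left ≫ (counitLeftIso hc e').hom =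
      (counitLeftIso hc e).hom ≫ k.left :=
  congrArg CommaMorphism.left ((sliceAdj adj X).counit_naturality k)

theorem sliceAdj_unit_app_counitLeftIso (hc : IsIso (sliceAdj adj X).counit) (d : Over X) :
    S.map ((sliceAdj adj X).unit.app d).left ≫ (counitLeftIso hc ((sliceS S X).obj d)).hom =
      𝟙 _ :=
  congrArg CommaMorphism.left ((sliceAdj adj X).left_triangle_components d)

end Local

/-! ### The monad of a morphism and the action on local objects -/

section Tensor

variable {A : Type u₁} [Category.{v₁} A] [HasPullbacks A]

/-- The monad `f^* f_!` on `A/X`. -/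
abbrev baseMonad {X Y : A} (f : X ⟶ Y) : Monad (Over X) := (Over.mapPullbackAdj f).toMonad

/-- The object `f^* f_! d = D ×_Y X` over `X`, for `d : D ⟶ X`. -/
abbrev tensor {X Y : A} (f : X ⟶ Y) (d : Over X) : Over X :=
  (Over.pullback f).obj ((Over.map f).obj d)

variable {X Y : A} (f : X ⟶ Y)

/-- The projection `D ×_Y X ⟶ D`. -/
def tensorFst (d : Over X) : (tensor f d).left ⟶ d.left :=
  pullback.fst (d.hom ≫ f) f

/-- The morphism `D ×_Y X ⟶ X ×_Y X` induced by `d : D ⟶ X`. -/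
def tensorToKer (d : Over X) : (tensor f d).left ⟶ pullback f f :=
  pullback.lift (pullback.fst (d.hom ≫ f) f ≫ d.hom) (pullback.snd (d.hom ≫ f) f)
    (by rw [Category.assoc, pullback.condition])

/-- The morphism `k ×_Y X : D ×_Y X ⟶ E ×_Y X` over `X`. -/
def tensorMap {d e : Over X} (k : d ⟶ e) : tensor f d ⟶ tensor f e :=
  (Over.pullback f).map ((Over.map f).map k)

/-- The multiplication `((x, y), z) ↦ (x, z)` of the monad `f^* f_!`. -/
def tensorMu (d : Over X) : tensor f (tensor f d) ⟶ tensor f d :=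
  (Over.pullback f).map ((Over.mapPullbackAdj f).counit.app ((Over.map f).obj d))

/-- The unit of the monad `f^* f_!`. -/
def tensorEta (d : Over X) : d ⟶ tensor f d := (Over.mapPullbackAdj f).unit.app d

theorem tensorToKer_fst (d : Over X) :
    tensorToKer f d ≫ pullback.fst f f = tensorFst f d ≫ d.hom := pullback.lift_fst _ _ _

theorem tensorToKer_snd (d : Over X) :
    tensorToKer f d ≫ pullback.snd f f = (tensor f d).hom := pullback.lift_snd _ _ _

theorem tensor_hom_ext' {d : Over X} {Z : A} {u v : Z ⟶ (tensor f d).left}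
    (h₁ : u ≫ tensorFst f d = v ≫ tensorFst f d)
    (h₂ : u ≫ (tensor f d).hom = v ≫ (tensor f d).hom) : u = v :=
  pullback.hom_ext h₁ h₂

theorem tensor_hom_ext {d : Over X} {Z : A} {u v : Z ⟶ (tensor f d).left}
    (h₁ : u ≫ tensorToKer f d = v ≫ tensorToKer f d)
    (h₂ : u ≫ tensorFst f d = v ≫ tensorFst f d) : u = v := by
  apply tensor_hom_ext' f h₂
  rw [← tensorToKer_snd, reassoc_of% h₁]

theorem exists_tensor_lift {d : Over X} {Z : A} (u : Z ⟶ d.left) (v : Z ⟶ X)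
    (h : u ≫ d.hom ≫ f = v ≫ f) :
    ∃ l : Z ⟶ (tensor f d).left, l ≫ tensorFst f d = u ∧ l ≫ (tensor f d).hom = v :=
  ⟨pullback.lift u v h, pullback.lift_fst _ _ _, pullback.lift_snd _ _ _⟩

/-- `D ×_Y X` is the pullback of `X ×_Y X` along `d : D ⟶ X`. -/
theorem isPullback_tensor (d : Over X) :
    IsPullback (tensorToKer f d) (tensorFst f d) (pullback.fst f f) d.hom := by
  have h (s : PullbackCone (pullback.fst f f) d.hom) :
      s.snd ≫ d.hom ≫ f = (s.fst ≫ pullback.snd f f) ≫ f := by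
    rw [← reassoc_of% s.condition, pullback.condition, Category.assoc]
  choose l h₁ h₂ using fun s => exists_tensor_lift f s.snd (s.fst ≫ pullback.snd f f) (h s)
  have h₃ (s) : l s ≫ tensorToKer f d = s.fst := by
    apply pullback.hom_ext
    · rw [Category.assoc, tensorToKer_fst, reassoc_of% h₁, s.condition]
    · rw [Category.assoc, tensorToKer_snd, h₂]
  refine ⟨⟨tensorToKer_fst f d⟩, ⟨PullbackCone.IsLimit.mk _ l h₃ h₁ fun s m e₁ e₂ => ?_⟩⟩
  exact tensor_hom_ext f (e₁.trans (h₃ s).symm) (e₂.trans (h₁ s).symm)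

theorem tensorMap_fst {d e : Over X} (k : d ⟶ e) :
    (tensorMap f k).left ≫ tensorFst f e = tensorFst f d ≫ k.left :=
  pullback.lift_fst _ _ _

theorem tensorMap_toKer {d e : Over X} (k : d ⟶ e) :
    (tensorMap f k).left ≫ tensorToKer f e = tensorToKer f d := by
  apply pullback.hom_ext
  · rw [Category.assoc, tensorToKer_fst, reassoc_of% @tensorMap_fst, Over.w, tensorToKer_fst]
  · rw [Category.assoc, tensorToKer_snd, tensorToKer_snd, Over.w]

theorem mapPullbackAdj_counit_left (a : Over Y) :
    ((Over.mapPullbackAdj f).counit.app a).left = pullback.fst a.hom f := by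
  rw [Over.mapPullbackAdj_counit_app]
  rfl

theorem tensorMu_fst (d : Over X) :
    (tensorMu f d).left ≫ tensorFst f d = tensorFst f (tensor f d) ≫ tensorFst f d := by
  refine (pullback.lift_fst _ _ _).trans ?_
  rw [mapPullbackAdj_counit_left]
  rfl

theorem tensorMu_toKer (d : Over X) :
    (tensorMu f d).left ≫ tensorToKer f d =
      kerComp f (tensorFst f (tensor f d) ≫ tensorToKer f d) (tensorToKer f (tensor f d))
        (by rw [Category.assoc, tensorToKer_snd, tensorToKer_fst]) := by
  apply pullback.hom_ext
  · rw [pullback.lift_fst, Category.assoc, Category.assoc, tensorToKer_fst,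
      reassoc_of% @tensorMu_fst]
  · rw [pullback.lift_snd, Category.assoc, tensorToKer_snd, tensorToKer_snd, Over.w]

theorem tensorEta_fst (d : Over X) : (tensorEta f d).left ≫ tensorFst f d = 𝟙 d.left := by
  rw [tensorEta, Over.mapPullbackAdj_unit_app]
  exact pullback.lift_fst _ _ _

theorem tensorEta_toKer (d : Over X) :
    (tensorEta f d).left ≫ tensorToKer f d = d.hom ≫ pullback.diagonal f := by
  apply pullback.hom_ext
  · rw [Category.assoc, tensorToKer_fst, reassoc_of% @tensorEta_fst, Category.assoc,
      pullback.diagonal_fst, Category.comp_id]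
  · rw [Category.assoc, tensorToKer_snd, Category.assoc, pullback.diagonal_snd, Category.comp_id,
      Over.w]

/-- The structure morphism of an algebra for `f^* f_!`. -/
def algMap (W : (baseMonad f).Algebra) : tensor f W.A ⟶ W.A := W.a

theorem algMap_unit (W : (baseMonad f).Algebra) :
    (tensorEta f W.A).left ≫ (algMap f W).left = 𝟙 W.A.left :=
  congrArg CommaMorphism.left W.unit

theorem algMap_assoc (W : (baseMonad f).Algebra) :
    (tensorMu f W.A).left ≫ (algMap f W).left =
      (tensorMap f (algMap f W)).left ≫ (algMap f W).left :=
  congrArg CommaMorphism.left W.assoc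

theorem algMap_naturality {W W' : (baseMonad f).Algebra} (k : W ⟶ W') :
    (tensorMap f k.f).left ≫ (algMap f W').left = (algMap f W).left ≫ k.f.left :=
  congrArg CommaMorphism.left k.h

/-- The algebra for `f^* f_!` on `f^* a` given by `a`. -/
abbrev baseAlgebra (a : Over Y) : (baseMonad f).Algebra :=
  (Monad.comparison (Over.mapPullbackAdj f)).obj a

end Tensor

section Act

variable {A : Type u₁} [Category.{v₁} A] {B : Type u₂} [Category.{v₂} B] {S : A ⥤ B} {C : B ⥤ A}
  [HasPullbacks A]

/-- The functor `f^* f_!` preserves local objects, since they are of the form `C_X(e)`, and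
`f_! C_X(e)` is split. -/
theorem isLocal_tensor {adj : S ⊣ C} {X Y : A} {f : X ⟶ Y}
    (hf : IsRelativeGaloisDescent adj f) {d : Over X} (hd : IsLocal adj d) :
    IsLocal adj (tensor f d) :=
  isIso_unit_of_iso (sliceAdj adj X)
    ((Over.map f ⋙ Over.pullback f).mapIso (@asIso _ _ _ _ _ hd).symm)
    (hf.split ((sliceS S X).obj d))

theorem isLocal_baseAlgebra {adj : S ⊣ C} {X Y : A} {f : X ⟶ Y}
    (a : Split adj f) : IsLocal adj (baseAlgebra f a.obj).A := a.property

end Act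

section Act

variable {A : Type u₁} [Category.{v₁} A] {B : Type u₂} [Category.{v₂} B] {S : A ⥤ B} {C : B ⥤ A}
  [HasPullbacks A] [HasPullbacks B]

variable {adj : S ⊣ C} {X Y : A} {f : X ⟶ Y} (hf : IsRelativeGaloisDescent adj f)

/-- The image under `S` of a morphism to `X ×_Y X`, as a generalized arrow of `Gal[f]`. -/
def galMap {Z : A} (α : Z ⟶ pullback f f) : S.obj Z ⟶ hf.gal.arr := S.map α

theorem map_galMap {Z Z' : A} (t : Z' ⟶ Z) (α : Z ⟶ pullback f f) :
    S.map t ≫ galMap hf α = galMap hf (t ≫ α) := (S.map_comp _ _).symm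

theorem galMap_src {Z : A} (α : Z ⟶ pullback f f) :
    galMap hf α ≫ hf.gal.src = S.map (α ≫ pullback.fst f f) := (S.map_comp _ _).symm

theorem galMap_tgt {Z : A} (α : Z ⟶ pullback f f) :
    galMap hf α ≫ hf.gal.tgt = S.map (α ≫ pullback.snd f f) := (S.map_comp _ _).symm

theorem map_one {Z : A} (x : Z ⟶ X) :
    S.map x ≫ hf.gal.one = galMap hf (x ≫ pullback.diagonal f) := (S.map_comp _ _).symm

theorem mul_galMap {Z : A} {T : B} (t : T ⟶ S.obj Z) (α β : Z ⟶ pullback f f)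
    (w : α ≫ pullback.snd f f = β ≫ pullback.fst f f) {a b : T ⟶ hf.gal.arr}
    (ha : a = t ≫ galMap hf α) (hb : b = t ≫ galMap hf β)
    (h : a ≫ hf.gal.tgt = b ≫ hf.gal.src) :
    hf.gal.mul a b h = t ≫ galMap hf (kerComp f α β w) :=
  galComp_spec adj f hf.counit_iso hf.selfSplit t α β w ha hb h

/-- `S` sends `D ×_Y X` to the pullback of the source map of `Gal[f]` along `S(d)`, when `d` is
local. -/
theorem isPullback_map_tensor {d : Over X} (hd : IsLocal adj d) :
    IsPullback (galMap hf (tensorToKer f d)) (S.map (tensorFst f d)) hf.gal.src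
      (S.map d.hom) := by
  have h := (preserves_pullback adj hf.counit_iso d.hom (pullback.fst f f) (pullback.snd f f)
    (isPullback_of_isIso_unit adj d hd) (isPullback_of_selfSplit adj f hf.selfSplit)).1
  have hi := (IsPullback.of_hasPullback d.hom (pullback.fst f f)).flip
  let i := (isPullback_tensor f d).isoIsPullback _ _ hi
  refine IsPullback.of_iso h.flip (S.mapIso i.symm) (Iso.refl _) (Iso.refl _) (Iso.refl _)
    ?_ ?_ ?_ ?_
  · refine (Category.comp_id _).trans (Eq.trans ?_ (S.map_comp _ _))
    exact congrArg S.map (IsPullback.isoIsPullback_inv_fst _ _ _ _).symm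
  · refine (Category.comp_id _).trans (Eq.trans ?_ (S.map_comp _ _))
    exact congrArg S.map (IsPullback.isoIsPullback_inv_snd _ _ _ _).symm
  · exact (Category.comp_id _).trans (Category.id_comp _).symm
  · exact (Category.comp_id _).trans (Category.id_comp _).symm

theorem exists_tensor {d : Over X} (hd : IsLocal adj d) {T : B} (a : T ⟶ hf.gal.arr)
    (x : T ⟶ S.obj d.left) (w : a ≫ hf.gal.src = x ≫ S.map d.hom) :
    ∃ t : T ⟶ S.obj (tensor f d).left,
      a = t ≫ galMap hf (tensorToKer f d) ∧ x = t ≫ S.map (tensorFst f d) :=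
  ⟨(isPullback_map_tensor hf hd).lift a x w, ((isPullback_map_tensor hf hd).lift_fst _ _ _).symm,
    ((isPullback_map_tensor hf hd).lift_snd _ _ _).symm⟩

/-- The action map `G₁ ×_{G₀} S(D) ≅ S(D ×_Y X) ⟶ S(D)` induced by a morphism
`α : D ×_Y X ⟶ D` over `X`, when `d : D ⟶ X` is local. -/
def actMap {d : Over X} (hd : IsLocal adj d) (α : tensor f d ⟶ d) :
    pullback hf.gal.src (S.map d.hom) ⟶ S.obj d.left :=
  (isPullback_map_tensor hf hd).isoPullback.inv ≫ S.map α.left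

theorem actMap_spec {d : Over X} (hd : IsLocal adj d) (α : tensor f d ⟶ d) {T : B}
    (t : T ⟶ S.obj (tensor f d).left) {a : T ⟶ hf.gal.arr} {x : T ⟶ S.obj d.left}
    (ha : a = t ≫ galMap hf (tensorToKer f d)) (hx : x = t ≫ S.map (tensorFst f d))
    (w : a ≫ hf.gal.src = x ≫ S.map d.hom) :
    pullback.lift a x w ≫ actMap hf hd α = t ≫ S.map α.left := by
  have h : pullback.lift a x w = t ≫ (isPullback_map_tensor hf hd).isoPullback.hom := by
    apply pullback.hom_ext
    · rw [pullback.lift_fst, Category.assoc, IsPullback.isoPullback_hom_fst, ha]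
    · rw [pullback.lift_snd, Category.assoc, IsPullback.isoPullback_hom_snd, hx]
  rw [h, actMap, Category.assoc, Iso.hom_inv_id_assoc]

/-- The action of `Gal[f]` on `S(D)` given by a structure of algebra for `f^* f_!` on a local object
`d : D ⟶ X`. -/
def actionOfAlgebra (W : (baseMonad f).Algebra) (hW : IsLocal adj W.A) : hf.gal.Action where
  obj := S.obj W.A.left
  proj := S.map W.A.hom
  act := actMap hf hW (algMap f W)
  act_proj := by
    rw [actMap, Category.assoc, ← S.map_comp, Over.w, Iso.inv_comp_eq,
      IsPullback.isoPullback_hom_fst_assoc, galMap_tgt, tensorToKer_snd]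
  one_act h := by
    rw [actMap_spec hf hW (algMap f W) (S.map (tensorEta f W.A).left), ← S.map_comp, algMap_unit,
      S.map_id]
    · rw [map_one, map_galMap, tensorEta_toKer]
    · rw [← S.map_comp, tensorEta_fst, S.map_id]
  mul_act a b x hax hab h h' := by
    obtain ⟨t, rfl, rfl⟩ := exists_tensor hf hW a x hax
    have hT := isLocal_tensor hf hW
    obtain ⟨t', rfl, rfl⟩ := exists_tensor hf hT b t (by
      rw [← hab, Category.assoc, galMap_tgt, tensorToKer_snd])
    rw [actMap_spec hf hW (algMap f W) (t' ≫ S.map (tensorMu f W.A).left),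
      actMap_spec hf hW (algMap f W) (t' ≫ S.map (tensorMap f (algMap f W)).left), Category.assoc,
      ← S.map_comp, algMap_assoc, Category.assoc, S.map_comp]
    · rw [Category.assoc, map_galMap, tensorMap_toKer]
    · refine (actMap_spec hf hW (algMap f W) (t' ≫ S.map (tensorFst f (tensor f W.A)))
        rfl rfl _).trans ?_
      rw [Category.assoc, ← S.map_comp, Category.assoc, ← S.map_comp, tensorMap_fst]
    · refine (mul_galMap hf t' (tensorFst f (tensor f W.A) ≫ tensorToKer f W.A)
        (tensorToKer f (tensor f W.A)) (by rw [Category.assoc, tensorToKer_snd, tensorToKer_fst])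
        (by rw [Category.assoc, map_galMap]) rfl _).trans ?_
      refine Eq.trans ?_ (Category.assoc _ _ _).symm
      rw [map_galMap, tensorMu_toKer]
    · rw [Category.assoc, Category.assoc, ← S.map_comp, ← S.map_comp, tensorMu_fst]

end Act

/-! ### The equivalence between split objects and actions -/

section Equivalence

namespace InternalGroupoid.Action

variable {B : Type u₂} [Category.{v₂} B] [HasPullbacks B] {G₀ : B} {G : InternalGroupoid G₀}

theorem hom_ext {P Q : G.Action} {k l : P ⟶ Q} (h : k.hom = l.hom) : k = l := Hom.ext h

/-- Equivariance in terms of generalized elements. -/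
theorem act_hom {P Q : G.Action} (k : P ⟶ Q) {T : B} (a : T ⟶ G.arr) (x : T ⟶ P.obj)
    (w : a ≫ G.src = x ≫ P.proj) (w' : a ≫ G.src = (x ≫ k.hom) ≫ Q.proj) :
    (pullback.lift a x w ≫ P.act) ≫ k.hom = pullback.lift a (x ≫ k.hom) w' ≫ Q.act := by
  rw [Category.assoc, k.equivariant k.cond, ← Category.assoc]
  congr 1
  apply pullback.hom_ext
  · rw [Category.assoc, pullback.lift_fst, pullback.lift_fst, pullback.lift_fst]
  · rw [Category.assoc, pullback.lift_snd, pullback.lift_snd, pullback.lift_snd_assoc]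

/-- Identities act trivially on generalized elements. -/
theorem lift_one_act (P : G.Action) {T : B} (x : T ⟶ P.obj)
    (h : ((x ≫ P.proj) ≫ G.one) ≫ G.src = x ≫ P.proj) :
    pullback.lift ((x ≫ P.proj) ≫ G.one) x h ≫ P.act = x := by
  have h₁ : (P.proj ≫ G.one) ≫ G.src = 𝟙 P.obj ≫ P.proj := by
    rw [Category.assoc, G.one_src, Category.comp_id, Category.id_comp]
  have h₂ := congrArg (x ≫ ·) (P.one_act h₁)
  simp only [Category.comp_id] at h₂
  conv_rhs => rw [← h₂]
  rw [← Category.assoc x]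
  congr 1
  apply pullback.hom_ext <;> simp [pullback.lift_fst, pullback.lift_snd]

theorem act_eq_lift (P : G.Action) : P.act =
    pullback.lift (pullback.fst G.src P.proj) (pullback.snd G.src P.proj) pullback.condition ≫
      P.act := by
  rw [show pullback.lift (pullback.fst G.src P.proj) (pullback.snd G.src P.proj)
    pullback.condition = 𝟙 _ by apply pullback.hom_ext <;> simp, Category.id_comp]

/-- A morphism of actions whose underlying morphism is invertible is an isomorphism. -/
theorem isIso_of_isIso_hom {P Q : G.Action} (k : P ⟶ Q) (h : IsIso k.hom) : IsIso k := by
  have w : CategoryTheory.inv k.hom ≫ P.proj = Q.proj := by rw [IsIso.inv_comp_eq, k.w]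
  have e : pullback.fst G.src Q.proj ≫ G.src =
      (pullback.snd G.src Q.proj ≫ CategoryTheory.inv k.hom) ≫ P.proj := by
    rw [Category.assoc, w, pullback.condition]
  let l : Q ⟶ P :=
    { hom := CategoryTheory.inv k.hom
      w := w
      equivariant := fun h' => by
        rw [IsIso.comp_inv_eq, act_hom k _ _ h' (by simp [pullback.condition])]
        conv_lhs => rw [act_eq_lift]
        congr 1
        apply pullback.hom_ext <;> simp }
  exact ⟨l, hom_ext (IsIso.hom_inv_id k.hom), hom_ext (IsIso.inv_hom_id k.hom)⟩

end InternalGroupoid.Action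

open InternalGroupoid

variable {A : Type u₁} [Category.{v₁} A] {B : Type u₂} [Category.{v₂} B] {S : A ⥤ B} {C : B ⥤ A}
  [HasPullbacks A] [HasPullbacks B]

variable {adj : S ⊣ C} {X Y : A} {f : X ⟶ Y} (hf : IsRelativeGaloisDescent adj f)

/-- Equivariance of a morphism out of `S(D)` can be tested on the generalized element of
`G₁ ×_{G₀} S(D)` given by `S(D ×_Y X)`, where the action is `S` of the algebra structure. -/
theorem actionOfAlgebra_equivariant_iff {W : (baseMonad f).Algebra} (hW : IsLocal adj W.A)
    (Q : hf.gal.Action) (g : S.obj W.A.left ⟶ Q.obj) (w : g ≫ Q.proj = S.map W.A.hom) :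
    (∀ h : pullback.fst hf.gal.src (S.map W.A.hom) ≫ hf.gal.src =
      (pullback.snd hf.gal.src (S.map W.A.hom) ≫ g) ≫ Q.proj,
      actMap hf hW (algMap f W) ≫ g =
        pullback.lift (pullback.fst hf.gal.src (S.map W.A.hom))
          (pullback.snd hf.gal.src (S.map W.A.hom) ≫ g) h ≫ Q.act) ↔
    ∀ h : galMap hf (tensorToKer f W.A) ≫ hf.gal.src = (S.map (tensorFst f W.A) ≫ g) ≫ Q.proj,
      S.map (algMap f W).left ≫ g =
        pullback.lift (galMap hf (tensorToKer f W.A)) (S.map (tensorFst f W.A) ≫ g) h ≫ Q.act := by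
  have e : pullback.fst hf.gal.src (S.map W.A.hom) ≫ hf.gal.src =
      (pullback.snd hf.gal.src (S.map W.A.hom) ≫ g) ≫ Q.proj := by
    rw [Category.assoc, w, pullback.condition]
  have e' : galMap hf (tensorToKer f W.A) ≫ hf.gal.src =
      (S.map (tensorFst f W.A) ≫ g) ≫ Q.proj := by
    rw [Category.assoc, w, (isPullback_map_tensor hf hW).w]
  have key : pullback.lift (galMap hf (tensorToKer f W.A)) (S.map (tensorFst f W.A) ≫ g) e' =
      (isPullback_map_tensor hf hW).isoPullback.hom ≫
        pullback.lift (pullback.fst hf.gal.src (S.map W.A.hom))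
          (pullback.snd hf.gal.src (S.map W.A.hom) ≫ g) e := by
    apply pullback.hom_ext
    · rw [Category.assoc, pullback.lift_fst, pullback.lift_fst, IsPullback.isoPullback_hom_fst]
    · rw [Category.assoc, pullback.lift_snd, pullback.lift_snd,
        IsPullback.isoPullback_hom_snd_assoc]
  refine Iff.trans (forall_prop_of_true e) (Iff.trans ?_ (forall_prop_of_true e').symm)
  rw [key, actMap, Category.assoc, Iso.inv_comp_eq, Category.assoc]

/-- The morphism of actions induced by a morphism of algebras with local underlying objects. -/
def actionHomOfAlgebraHom {W W' : (baseMonad f).Algebra} (hW : IsLocal adj W.A)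
    (hW' : IsLocal adj W'.A) (k : W ⟶ W') :
    actionOfAlgebra hf W hW ⟶ actionOfAlgebra hf W' hW' :=
  have hw : S.map k.f.left ≫ S.map W'.A.hom = S.map W.A.hom := by rw [← S.map_comp, Over.w]
  { hom := S.map k.f.left
    w := hw
    equivariant := (actionOfAlgebra_equivariant_iff hf hW (actionOfAlgebra hf W' hW')
      (S.map k.f.left) hw).2 (fun h => by
        have e₁ : galMap hf (tensorToKer f W.A) =
            S.map (tensorMap f k.f).left ≫ galMap hf (tensorToKer f W'.A) := by
          rw [map_galMap, tensorMap_toKer]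
        have e₂ : S.map (tensorFst f W.A) ≫ S.map k.f.left =
            S.map (tensorMap f k.f).left ≫ S.map (tensorFst f W'.A) := by
          rw [← S.map_comp, ← S.map_comp, tensorMap_fst]
        have e₃ : S.map (tensorMap f k.f).left ≫ S.map (algMap f W').left =
            S.map (algMap f W).left ≫ S.map k.f.left := by
          rw [← S.map_comp, ← S.map_comp, algMap_naturality]
        exact ((actMap_spec hf hW' (algMap f W') _ e₁ e₂ h).trans e₃).symm) }

theorem exists_algebraHom {W W' : (baseMonad f).Algebra} (hW : IsLocal adj W.A)
    (hW' : IsLocal adj W'.A) (g : actionOfAlgebra hf W hW ⟶ actionOfAlgebra hf W' hW') :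
    ∃ k : W ⟶ W', actionHomOfAlgebraHom hf hW hW' k = g := by
  have he := (actionOfAlgebra_equivariant_iff hf hW (actionOfAlgebra hf W' hW') g.hom g.w).1
    g.equivariant
  obtain ⟨g', hg⟩ : ∃ g' : S.obj W.A.left ⟶ S.obj W'.A.left, g' = g.hom := ⟨_, rfl⟩
  have gw : g' ≫ S.map W'.A.hom = S.map W.A.hom := by
    rw [hg]
    exact g.w
  rw [← hg] at he
  obtain ⟨k, rfl⟩ := hW'.exists_hom g' gw
  have e : galMap hf (tensorToKer f W.A) ≫ hf.gal.src =
      (S.map (tensorFst f W.A) ≫ S.map k.left) ≫ S.map W'.A.hom := by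
    rw [Category.assoc, gw, (isPullback_map_tensor hf hW).w]
  have e₁ : galMap hf (tensorToKer f W.A) =
      S.map (tensorMap f k).left ≫ galMap hf (tensorToKer f W'.A) := by
    rw [map_galMap, tensorMap_toKer]
  have e₂ : S.map (tensorFst f W.A) ≫ S.map k.left =
      S.map (tensorMap f k).left ≫ S.map (tensorFst f W'.A) := by
    rw [← S.map_comp, ← S.map_comp, tensorMap_fst]
  have h : tensorMap f k ≫ algMap f W' = algMap f W ≫ k := by
    refine hW'.hom_ext ?_
    rw [Over.comp_left, Over.comp_left, S.map_comp, S.map_comp]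
    exact ((he e).trans (actMap_spec hf hW' (algMap f W') _ e₁ e₂ e)).symm
  exact ⟨⟨k, h⟩, InternalGroupoid.Action.hom_ext hg⟩

/-- Every action of `Gal[f]` on `e : E ⟶ S(X)` comes from an algebra structure on `C_X(e)`. -/
theorem exists_algebra (Q : hf.gal.Action) :
    ∃ (W : (baseMonad f).Algebra) (hW : IsLocal adj W.A),
      Nonempty (actionOfAlgebra hf W hW ≅ Q) := by
  have hc := hf.counit_iso
  let e : Over (S.obj X) := Over.mk Q.proj
  let d : Over X := (sliceC adj X).obj e
  have hd : IsLocal adj d := isIso_unit_obj (sliceAdj adj X) hc e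
  let i : S.obj d.left ≅ Q.obj := counitLeftIso hc e
  have hi : i.hom ≫ Q.proj = S.map d.hom := counitLeftIso_hom_comp hc e
  have hw : galMap hf (tensorToKer f d) ≫ hf.gal.src =
      (S.map (tensorFst f d) ≫ i.hom) ≫ Q.proj := by
    rw [Category.assoc, hi, (isPullback_map_tensor hf hd).w]
  obtain ⟨α, hα⟩ := hd.exists_hom
    ((pullback.lift (galMap hf (tensorToKer f d)) (S.map (tensorFst f d) ≫ i.hom) hw ≫ Q.act) ≫
      i.inv : S.obj (tensor f d).left ⟶ S.obj d.left) (by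
      rw [← hi, Category.assoc, Iso.inv_hom_id_assoc, Category.assoc, Q.act_proj,
        pullback.lift_fst_assoc, galMap_tgt, tensorToKer_snd])
  have hα' : S.map α.left ≫ i.hom =
      pullback.lift (galMap hf (tensorToKer f d)) (S.map (tensorFst f d) ≫ i.hom) hw ≫ Q.act := by
    rw [hα, Category.assoc, Iso.inv_hom_id, Category.comp_id]
  -- the action on generalized elements of `S(D ×_Y X)` in terms of `α`
  have spec {T : B} (t : T ⟶ S.obj (tensor f d).left) {a : T ⟶ hf.gal.arr} {x : T ⟶ Q.obj}
      (ha : a = t ≫ galMap hf (tensorToKer f d)) (hx : x = t ≫ S.map (tensorFst f d) ≫ i.hom)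
      (w : a ≫ hf.gal.src = x ≫ Q.proj) :
      pullback.lift a x w ≫ Q.act = t ≫ S.map α.left ≫ i.hom := by
    rw [hα', ← Category.assoc]
    congr 1
    apply pullback.hom_ext
    · rw [Category.assoc, pullback.lift_fst, pullback.lift_fst, ha]
    · rw [Category.assoc, pullback.lift_snd, pullback.lift_snd, hx]
  have unit : tensorEta f d ≫ α = 𝟙 d := by
    refine hd.hom_ext ?_
    rw [← cancel_mono i.hom, Over.comp_left, S.map_comp, Over.id_left, S.map_id, Category.id_comp,
      Category.assoc]
    have h2 : ((i.hom ≫ Q.proj) ≫ hf.gal.one) ≫ hf.gal.src = i.hom ≫ Q.proj := by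
      rw [Category.assoc, hf.gal.one_src, Category.comp_id]
    refine (spec (S.map (tensorEta f d).left) ?_ ?_ h2).symm.trans ?_
    · rw [hi, map_one, map_galMap, tensorEta_toKer]
    · rw [← Category.assoc, ← S.map_comp, tensorEta_fst, S.map_id, Category.id_comp]
    · exact Q.lift_one_act i.hom h2
  have assoc : tensorMu f d ≫ α = tensorMap f α ≫ α := by
    refine hd.hom_ext ?_
    rw [← cancel_mono i.hom, Over.comp_left, Over.comp_left, S.map_comp, S.map_comp,
      Category.assoc, Category.assoc]
    let a : S.obj (tensor f (tensor f d)).left ⟶ hf.gal.arr :=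
      S.map (tensorFst f (tensor f d)) ≫ galMap hf (tensorToKer f d)
    let b : S.obj (tensor f (tensor f d)).left ⟶ hf.gal.arr :=
      galMap hf (tensorToKer f (tensor f d))
    let x : S.obj (tensor f (tensor f d)).left ⟶ Q.obj :=
      S.map (tensorFst f (tensor f d)) ≫ S.map (tensorFst f d) ≫ i.hom
    have hax : a ≫ hf.gal.src = x ≫ Q.proj := by
      simp only [a, x, Category.assoc] at hw ⊢
      rw [hw]
    have hab : a ≫ hf.gal.tgt = b ≫ hf.gal.src := by
      simp only [a, b, Category.assoc]
      rw [galMap_tgt, galMap_src, tensorToKer_snd, tensorToKer_fst, S.map_comp]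
    have hx : pullback.lift a x hax ≫ Q.act =
        S.map (tensorFst f (tensor f d)) ≫ S.map α.left ≫ i.hom :=
      spec (S.map (tensorFst f (tensor f d))) rfl rfl hax
    have h : hf.gal.mul a b hab ≫ hf.gal.src = x ≫ Q.proj := by rw [mul_src, hax]
    have h' : b ≫ hf.gal.src = (pullback.lift a x hax ≫ Q.act) ≫ Q.proj := by
      rw [Category.assoc, Q.act_proj, pullback.lift_fst_assoc, hab]
    refine (spec (S.map (tensorMu f d).left) ?_ ?_ h).symm.trans ((Q.mul_act a b x hax hab h
      h').trans (spec (S.map (tensorMap f α).left) ?_ ?_ h'))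
    · refine (mul_galMap hf (𝟙 _) (tensorFst f (tensor f d) ≫ tensorToKer f d)
        (tensorToKer f (tensor f d)) (by rw [Category.assoc, tensorToKer_snd, tensorToKer_fst])
        (by rw [Category.id_comp, ← map_galMap]) (Category.id_comp _).symm _).trans ?_
      rw [Category.id_comp, map_galMap, tensorMu_toKer]
    · simp only [x]
      rw [← S.map_comp_assoc, ← S.map_comp_assoc, tensorMu_fst]
    · rw [map_galMap, tensorMap_toKer]
    · rw [hx, ← S.map_comp_assoc, ← S.map_comp_assoc, tensorMap_fst]
  refine ⟨⟨d, α, unit, assoc⟩, hd, ?_⟩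
  let k : actionOfAlgebra hf ⟨d, α, unit, assoc⟩ hd ⟶ Q :=
    { hom := i.hom
      w := hi
      equivariant := (actionOfAlgebra_equivariant_iff hf (W := ⟨d, α, unit, assoc⟩) hd Q i.hom
        hi).2 fun _ => hα' }
  have hk : IsIso k := InternalGroupoid.Action.isIso_of_isIso_hom k (inferInstanceAs (IsIso i.hom))
  exact ⟨asIso k⟩

theorem isIso_actionHomOfAlgebraHom {W W' : (baseMonad f).Algebra} (hW : IsLocal adj W.A)
    (hW' : IsLocal adj W'.A) (k : W ⟶ W') [IsIso k] :
    IsIso (actionHomOfAlgebraHom hf hW hW' k) := by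
  have h : IsIso ((Monad.forget (baseMonad f)).map k) := inferInstance
  have h' : IsIso (S.map ((Over.forget X).map ((Monad.forget (baseMonad f)).map k))) :=
    inferInstance
  exact InternalGroupoid.Action.isIso_of_isIso_hom _ h'

/-- The functor sending an object `a` split by `f` to `S(f^* a)` with its action of `Gal[f]`. -/
def splitToAction : Split adj f ⥤ hf.gal.Action where
  obj a := actionOfAlgebra hf (baseAlgebra f a.obj) (isLocal_baseAlgebra a)
  map {a b} k := actionHomOfAlgebraHom hf (isLocal_baseAlgebra a) (isLocal_baseAlgebra b)
    ((Monad.comparison (Over.mapPullbackAdj f)).map k.hom)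
  map_id a := InternalGroupoid.Action.hom_ext (by
    refine (congrArg (fun k => S.map k.left)
      ((Over.pullback f).map_id a.obj)).trans ?_
    exact S.map_id _)
  map_comp k l := InternalGroupoid.Action.hom_ext (by
    refine (congrArg (fun k => S.map k.left)
      ((Over.pullback f).map_comp k.hom l.hom)).trans ?_
    exact S.map_comp _ _)

theorem splitToAction_faithful : (splitToAction hf).Faithful where
  map_injective {a b} k l h := by
    have := hf.monadic
    refine ObjectProperty.hom_ext _ ((Monad.comparison (Over.mapPullbackAdj f)).map_injective ?_)
    ext1
    exact (isLocal_baseAlgebra b).hom_ext (congrArg InternalGroupoid.Action.Hom.hom h)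

theorem splitToAction_full : (splitToAction hf).Full where
  map_surjective {a b} g := by
    have := hf.monadic
    obtain ⟨k, hk⟩ := exists_algebraHom hf (isLocal_baseAlgebra a) (isLocal_baseAlgebra b) g
    obtain ⟨l, hl⟩ := (Monad.comparison (Over.mapPullbackAdj f)).map_surjective k
    refine ⟨ObjectProperty.homMk l, ?_⟩
    rw [← hk, ← hl]
    rfl

theorem splitToAction_essSurj : (splitToAction hf).EssSurj where
  mem_essImage Q := by
    have := hf.monadic
    obtain ⟨W, hW, ⟨i⟩⟩ := exists_algebra hf Q
    obtain ⟨a, ⟨j⟩⟩ := Functor.EssSurj.mem_essImage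
      (F := Monad.comparison (Over.mapPullbackAdj f)) W
    have ha : IsLocal adj (baseAlgebra f a).A :=
      isIso_unit_of_iso (sliceAdj adj X) ((Monad.forget (baseMonad f)).mapIso j.symm) hW
    have hk : IsIso (actionHomOfAlgebraHom hf ha hW j.hom) :=
      isIso_actionHomOfAlgebraHom hf ha hW j.hom
    exact ⟨⟨a, ha⟩, ⟨@asIso _ _ _ _ _ hk ≪≫ i⟩⟩

/-- The categorical Galois theorem: objects split by `f` are the same as actions of `Gal[f]`. -/
instance splitToAction_isEquivalence : (splitToAction hf).IsEquivalence where
  faithful := splitToAction_faithful hf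
  full := splitToAction_full hf
  essSurj := splitToAction_essSurj hf

end Equivalence

/-! ### Effective subgroupoids as effective equivalence relations on `X` -/

section ExactFork

variable {D : Type u₁} [Category.{v₁} D] {E : Type u₂} [Category.{v₂} E]

/-- The fork `R ⇉ T ⟶ Q` is exact: `q` is the coequaliser of `a` and `b`, and these form its kernel
pair. -/
def IsExactFork {R T Q : D} (a b : R ⟶ T) (q : T ⟶ Q) : Prop :=
  ∃ w : a ≫ q = b ≫ q, Nonempty (IsColimit (Cofork.ofπ q w)) ∧ IsKernelPair q a b

theorem IsExactFork.of_iso {R T Q : D} {a b : R ⟶ T} {q : T ⟶ Q} (h : IsExactFork a b q)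
    {R' T' Q' : D} {a' b' : R' ⟶ T'} {q' : T' ⟶ Q'} (e : R ≅ R') (r : T ≅ T') (i : Q ≅ Q')
    (ha : e.hom ≫ a' = a ≫ r.hom) (hb : e.hom ≫ b' = b ≫ r.hom)
    (hq : q ≫ i.hom = r.hom ≫ q') : IsExactFork a' b' q' := by
  obtain ⟨w, ⟨hc⟩, hk⟩ := h
  have hk' : IsKernelPair q' a' b' := IsPullback.of_iso hk e r r i ha.symm hb.symm hq hq
  refine ⟨hk'.w, ⟨?_⟩, hk'⟩
  exact Cofork.isColimitOfIsos _ hc _ e r i ha hb (by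
    change r.inv ≫ q ≫ i.hom = q'
    rw [hq, Iso.inv_hom_id_assoc])

theorem isExactFork_map_iff (L : D ⥤ E) [L.IsEquivalence] {R T Q : D} (a b : R ⟶ T) (q : T ⟶ Q) :
    IsExactFork (L.map a) (L.map b) (L.map q) ↔ IsExactFork a b q := by
  constructor
  · rintro ⟨w, ⟨hc⟩, hk⟩
    have w' : a ≫ q = b ≫ q := L.map_injective (by rw [L.map_comp, L.map_comp, w])
    exact ⟨w', ⟨isColimitOfIsColimitCoforkMap L w' hc⟩, IsPullback.of_map L w' hk⟩
  · rintro ⟨w, ⟨hc⟩, hk⟩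
    exact ⟨by rw [← L.map_comp, w, L.map_comp], ⟨isColimitCoforkMapOfIsColimit L w hc⟩,
      IsPullback.map L hk⟩

end ExactFork

section Coset

variable {A : Type u₁} [Category.{v₁} A] {B : Type u₂} [Category.{v₂} B] {S : A ⥤ B} {C : B ⥤ A}
  [HasPullbacks A] [HasPullbacks B]

variable {adj : S ⊣ C} {X Y : A} {f : X ⟶ Y} (hf : IsRelativeGaloisDescent adj f)

theorem isIso_galMap_id : IsIso (galMap hf (𝟙 (pullback f f))) :=
  inferInstanceAs (IsIso (S.map (𝟙 (pullback f f))))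

theorem algMap_baseAlgebra_fst (f : X ⟶ Y) (a : Over Y) :
    (algMap f (baseAlgebra f a)).left ≫ pullback.fst a.hom f =
      tensorFst f (baseAlgebra f a).A ≫ pullback.fst a.hom f := by
  refine (pullback.lift_fst _ _ _).trans ?_
  rw [mapPullbackAdj_counit_left]
  rfl

theorem algMap_baseAlgebra_self (f : X ⟶ Y) :
    (algMap f (baseAlgebra f (Over.mk f))).left =
      kerComp f (tensorFst f (baseAlgebra f (Over.mk f)).A)
        (tensorToKer f (baseAlgebra f (Over.mk f)).A) (tensorToKer_fst _ _).symm := by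
  apply pullback.hom_ext
  · exact (algMap_baseAlgebra_fst f (Over.mk f)).trans (pullback.lift_fst _ _ _).symm
  · exact (Over.w (algMap f (baseAlgebra f (Over.mk f)))).trans
      ((tensorToKer_snd _ _).symm.trans (pullback.lift_snd _ _ _).symm)

theorem regular_act_lift {G₀ : B} (G : InternalGroupoid G₀) {T : B} (a x : T ⟶ G.arr)
    (w : a ≫ G.src = x ≫ G.tgt) :
    pullback.lift a x w ≫ G.regular.act = G.mul x a w.symm := by
  refine (G.comp_mul _ _ _ _).trans (G.mul_congr ?_ ?_ _)
  · exact pullback.lift_snd _ _ _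
  · exact pullback.lift_fst _ _ _

/-- The object `f` of `Split_Y(f)` corresponds to the canonical action of `Gal[f]` on itself. -/
def topToRegular : (splitToAction hf).obj hf.top ⟶ hf.gal.regular :=
  have hw : galMap hf (𝟙 (pullback f f)) ≫ hf.gal.tgt =
      S.map (baseAlgebra f (Over.mk f)).A.hom := by
    rw [galMap_tgt, Category.id_comp]
    rfl
  { hom := galMap hf (𝟙 (pullback f f))
    w := hw
    equivariant := (actionOfAlgebra_equivariant_iff hf
      (isLocal_baseAlgebra hf.top) hf.gal.regular (galMap hf (𝟙 (pullback f f))) hw).2 (fun h => by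
        refine Eq.trans ?_ (regular_act_lift hf.gal _ _ h).symm
        refine Eq.trans ?_ (mul_galMap hf (𝟙 _) (tensorFst f (baseAlgebra f (Over.mk f)).A)
          (tensorToKer f (baseAlgebra f (Over.mk f)).A) (tensorToKer_fst _ _).symm
          ?_ (Category.id_comp _).symm _).symm
        · rw [Category.id_comp, ← algMap_baseAlgebra_self]
          exact (map_galMap hf _ _).trans (congrArg (galMap hf) (Category.comp_id _))
        · rw [Category.id_comp]
          exact (map_galMap hf _ _).trans (congrArg (galMap hf) (Category.comp_id _))) }

instance isIso_topToRegular : IsIso (topToRegular hf) :=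
  InternalGroupoid.Action.isIso_of_isIso_hom _ (isIso_galMap_id hf)

variable (H : Subobject hf.gal.arr)

/-- The local object `X ×_{S(X)} H` over `X`, where `H` lies over `S(X)` through the target map. -/
abbrev relObj : Over X := (sliceC adj X).obj (Over.mk (H.arrow ≫ hf.gal.tgt))

theorem isLocal_relObj : IsLocal adj (relObj hf H) :=
  isIso_unit_obj (sliceAdj adj X) hf.counit_iso _

/-- The isomorphism `S(X ×_{S(X)} H) ≅ H`. -/
def relIso : S.obj (relObj hf H).left ≅ (H : B) :=
  counitLeftIso hf.counit_iso (Over.mk (H.arrow ≫ hf.gal.tgt))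

theorem relIso_hom_comp :
    (relIso hf H).hom ≫ H.arrow ≫ hf.gal.tgt = S.map (relObj hf H).hom :=
  counitLeftIso_hom_comp hf.counit_iso (Over.mk (H.arrow ≫ hf.gal.tgt))

/-- The morphism `X ×_{S(X)} H ⟶ X ×_Y X`. -/
def relToKer : (relObj hf H).left ⟶ pullback f f := (quotRelToKer hf H).left

theorem relToKer_snd : relToKer hf H ≫ pullback.snd f f = (relObj hf H).hom :=
  Over.w (quotRelToKer hf H)

/-- Under `S`, the morphism `X ×_{S(X)} H ⟶ X ×_Y X` becomes the inclusion of `H`. -/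
theorem galMap_relToKer : galMap hf (relToKer hf H) = (relIso hf H).hom ≫ H.arrow := by
  have h₁ : quotRelToKer hf H ≫ (torsorIso hf).hom =
      (sliceC adj X).map (Over.homMk (U := Over.mk (H.arrow ≫ hf.gal.tgt))
        (V := Over.mk hf.gal.tgt) H.arrow rfl) := by
    rw [quotRelToKer, Category.assoc, Iso.inv_hom_id, Category.comp_id]
  have h₂ := counitLeftIso_naturality (adj := adj) hf.counit_iso
    (Over.homMk (U := Over.mk (H.arrow ≫ hf.gal.tgt)) (V := Over.mk hf.gal.tgt) H.arrow rfl)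
  rw [← h₁, Over.comp_left, S.map_comp, Category.assoc] at h₂
  have h₃ : S.map (torsorIso hf).hom.left ≫
      (counitLeftIso hf.counit_iso (Over.mk hf.gal.tgt)).hom = 𝟙 _ :=
    sliceAdj_unit_app_counitLeftIso hf.counit_iso ((Over.pullback f).obj (Over.mk f))
  rw [h₃] at h₂
  exact (Category.comp_id _).symm.trans h₂

theorem quotAct_left : (quotAct hf H).hom.left = relToKer hf H ≫ pullback.fst f f := by
  refine (Over.comp_left _ _ _ _ _).trans ?_
  rw [mapPullbackAdj_counit_left]
  rfl

theorem quotProj_left : (quotProj hf H).hom.left = relToKer hf H ≫ pullback.snd f f :=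
  (relToKer_snd hf H).symm

theorem pullback_quotProj_left :
    ((Over.pullback f).map (quotProj hf H).hom).left = tensorToKer f (relObj hf H) := by
  apply pullback.hom_ext
  · exact (pullback.lift_fst _ _ _).trans (tensorToKer_fst _ _).symm
  · exact (pullback.lift_snd _ _ _).trans (tensorToKer_snd _ _).symm

theorem tensor_relToKer_condition :
    (tensorFst f (relObj hf H) ≫ relToKer hf H) ≫ pullback.snd f f =
      tensorToKer f (relObj hf H) ≫ pullback.fst f f := by
  rw [Category.assoc, relToKer_snd, tensorToKer_fst]

theorem pullback_quotAct_left :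
    ((Over.pullback f).map (quotAct hf H).hom).left =
      kerComp f (tensorFst f (relObj hf H) ≫ relToKer hf H) (tensorToKer f (relObj hf H))
        (tensor_relToKer_condition hf H) := by
  apply pullback.hom_ext
  · refine (pullback.lift_fst _ _ _).trans (Eq.trans ?_ (pullback.lift_fst _ _ _).symm)
    rw [quotAct_left]
    exact (Category.assoc _ _ _).symm
  · exact (pullback.lift_snd _ _ _).trans
      ((tensorToKer_snd _ _).symm.trans (pullback.lift_snd _ _ _).symm)

theorem relToCoset_condition :
    galMap hf (tensorToKer f (relObj hf H)) ≫ hf.gal.src =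
      (S.map (tensorFst f (relObj hf H)) ≫ (relIso hf H).hom) ≫ H.arrow ≫ hf.gal.tgt := by
  rw [Category.assoc, relIso_hom_comp, (isPullback_map_tensor hf (isLocal_relObj hf H)).w]

/-- The isomorphism `S(f^* f_! (X ×_{S(X)} H)) ≅ G₁ ×_{G₀} H`. -/
def relToCosetMap : S.obj (tensor f (relObj hf H)).left ⟶
    pullback hf.gal.src (H.arrow ≫ hf.gal.tgt) :=
  pullback.lift (galMap hf (tensorToKer f (relObj hf H)))
    (S.map (tensorFst f (relObj hf H)) ≫ (relIso hf H).hom) (relToCoset_condition hf H)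

theorem relToCosetMap_fst : relToCosetMap hf H ≫ pullback.fst _ _ =
    galMap hf (tensorToKer f (relObj hf H)) := pullback.lift_fst _ _ _

theorem relToCosetMap_snd : relToCosetMap hf H ≫ pullback.snd _ _ =
    S.map (tensorFst f (relObj hf H)) ≫ (relIso hf H).hom := pullback.lift_snd _ _ _

/-- This is the preservation by `S` of the pullback defining `D ×_Y X`, for `D = X ×_{S(X)} H`. -/
theorem isIso_relToCosetMap : IsIso (relToCosetMap hf H) := by
  have h : IsPullback (galMap hf (tensorToKer f (relObj hf H)))
      (S.map (tensorFst f (relObj hf H)) ≫ (relIso hf H).hom) hf.gal.src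
      (H.arrow ≫ hf.gal.tgt) :=
    IsPullback.of_iso (isPullback_map_tensor hf (isLocal_relObj hf H)) (Iso.refl _) (Iso.refl _)
      (relIso hf H) (Iso.refl _) (by simp) (by simp) (by simp) (by
        rw [relIso_hom_comp]
        exact Category.comp_id _)
  have e : relToCosetMap hf H = h.isoPullback.hom := by
    apply pullback.hom_ext
    · rw [relToCosetMap_fst, h.isoPullback_hom_fst]
    · rw [relToCosetMap_snd, h.isoPullback_hom_snd]
  rw [e]
  infer_instance

theorem cosetRel_act_lift {G₀ : B} (G : InternalGroupoid G₀) (H : Subobject G.arr) {T : B}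
    (a : T ⟶ G.arr) (x : T ⟶ pullback G.src (H.arrow ≫ G.tgt))
    (w : a ≫ G.src = x ≫ (G.cosetRel H).proj)
    (w' : (x ≫ pullback.fst _ _) ≫ G.tgt = a ≫ G.src) (u : T ⟶ (G.cosetRel H).obj)
    (h₁ : u ≫ pullback.fst _ _ = G.mul (x ≫ pullback.fst _ _) a w')
    (h₂ : u ≫ pullback.snd _ _ = x ≫ pullback.snd _ _) :
    u = pullback.lift a x w ≫ (G.cosetRel H).act := by
  apply pullback.hom_ext
  · refine h₁.trans ?_
    refine Eq.trans ?_ (Category.assoc _ _ _).symm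
    refine Eq.trans ?_ (congrArg (pullback.lift a x w ≫ ·) (pullback.lift_fst _ _ _)).symm
    refine Eq.trans ?_ (G.comp_mul _ _ _ _).symm
    refine G.mul_congr ?_ ?_ _
    · exact (congrArg (· ≫ _) (pullback.lift_snd _ _ _).symm).trans (Category.assoc _ _ _)
    · exact (pullback.lift_fst _ _ _).symm
  · refine h₂.trans ?_
    refine Eq.trans ?_ (Category.assoc _ _ _).symm
    refine Eq.trans ?_ (congrArg (pullback.lift a x w ≫ ·) (pullback.lift_snd _ _ _)).symm
    exact (congrArg (· ≫ _) (pullback.lift_snd _ _ _).symm).trans (Category.assoc _ _ _)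

/-- The object `X ×_{S(X)} H` of `Split_Y(f)` corresponds to the action `G₁ ×_{G₀} H`. -/
def relToCoset : (splitToAction hf).obj (quotRel hf H) ⟶ hf.gal.cosetRel H :=
  have hw : relToCosetMap hf H ≫ (hf.gal.cosetRel H).proj =
      S.map (baseAlgebra f ((Over.map f).obj (relObj hf H))).A.hom := by
    change relToCosetMap hf H ≫ pullback.fst _ _ ≫ hf.gal.tgt = _
    rw [← Category.assoc, relToCosetMap_fst, galMap_tgt, tensorToKer_snd]
    rfl
  { hom := relToCosetMap hf H
    w := hw
    equivariant := (actionOfAlgebra_equivariant_iff hf (isLocal_baseAlgebra (quotRel hf H))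
      (hf.gal.cosetRel H) (relToCosetMap hf H) hw).2 (fun h => by
        have w' : ((S.map (tensorFst f (tensor f (relObj hf H))) ≫ relToCosetMap hf H) ≫
            pullback.fst _ _) ≫ hf.gal.tgt =
            galMap hf (tensorToKer f (tensor f (relObj hf H))) ≫ hf.gal.src := by
          rw [Category.assoc _ (relToCosetMap hf H), relToCosetMap_fst, map_galMap, galMap_tgt,
            galMap_src, Category.assoc, tensorToKer_snd, tensorToKer_fst]
        refine cosetRel_act_lift hf.gal H _ _ h w' _ ?_ ?_
        · change (S.map (tensorMu f (relObj hf H)).left ≫ relToCosetMap hf H) ≫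
            pullback.fst _ _ = _
          rw [Category.assoc, relToCosetMap_fst, map_galMap, tensorMu_toKer]
          refine Eq.trans ?_ (mul_galMap hf (𝟙 _)
            (tensorFst f (tensor f (relObj hf H)) ≫ tensorToKer f (relObj hf H))
            (tensorToKer f (tensor f (relObj hf H)))
            (by rw [Category.assoc, tensorToKer_snd, tensorToKer_fst])
            ?_ (Category.id_comp _).symm _).symm
          · rw [Category.id_comp]
          · refine (Category.assoc _ _ _).trans ?_
            rw [Category.id_comp]
            exact (congrArg (S.map (tensorFst f (tensor f (relObj hf H))) ≫ ·)
              (relToCosetMap_fst hf H)).trans (map_galMap hf _ _)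
        · change (S.map (tensorMu f (relObj hf H)).left ≫ relToCosetMap hf H) ≫
            pullback.snd _ _ =
            (S.map (tensorFst f (tensor f (relObj hf H))) ≫ relToCosetMap hf H) ≫ pullback.snd _ _
          rw [Category.assoc, relToCosetMap_snd, Category.assoc, relToCosetMap_snd,
            ← S.map_comp_assoc, ← S.map_comp_assoc, tensorMu_fst]) }

instance isIso_relToCoset : IsIso (relToCoset hf H) :=
  InternalGroupoid.Action.isIso_of_isIso_hom _ (isIso_relToCosetMap hf H)

theorem relToCoset_cosetFst : relToCoset hf H ≫ hf.gal.cosetFst H =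
    (splitToAction hf).map (quotProj hf H) ≫ topToRegular hf := by
  refine InternalGroupoid.Action.hom_ext ?_
  refine (relToCosetMap_fst hf H).trans ?_
  have h := map_galMap hf (tensorToKer f (relObj hf H)) (𝟙 _)
  rw [Category.comp_id, ← pullback_quotProj_left] at h
  rw [← pullback_quotProj_left]
  exact h.symm

theorem relToCoset_cosetMul : relToCoset hf H ≫ hf.gal.cosetMul H =
    (splitToAction hf).map (quotAct hf H) ≫ topToRegular hf := by
  refine InternalGroupoid.Action.hom_ext ?_
  have h := map_galMap hf (kerComp f (tensorFst f (relObj hf H) ≫ relToKer hf H)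
    (tensorToKer f (relObj hf H)) (tensor_relToKer_condition hf H)) (𝟙 _)
  rw [Category.comp_id, ← pullback_quotAct_left] at h
  refine Eq.trans ?_ h.symm
  rw [pullback_quotAct_left]
  refine (hf.gal.comp_mul _ _ _ _).trans ((mul_galMap hf (𝟙 _)
    (tensorFst f (relObj hf H) ≫ relToKer hf H) (tensorToKer f (relObj hf H))
    (tensor_relToKer_condition hf H) ?_ ?_ _).trans (Category.id_comp _))
  · rw [Category.id_comp, ← map_galMap, galMap_relToKer, ← Category.assoc]
    exact (Category.assoc _ _ _).symm.trans (congrArg (· ≫ H.arrow) (relToCosetMap_snd hf H))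
  · rw [Category.id_comp]
    exact relToCosetMap_fst hf H

/-- A subgroupoid `H` is effective exactly when the pair `X ×_{S(X)} H ⇉ X` in `Split_Y(f)` has a
coequaliser of which it is the kernel pair. -/
theorem isEffective_iff : hf.gal.IsEffective H ↔
    ∃ (Q : Split adj f) (q : hf.top ⟶ Q), IsExactFork (quotProj hf H) (quotAct hf H) q := by
  let L := splitToAction hf
  let r := asIso (topToRegular hf)
  let j := asIso (relToCoset hf H)
  have h₁ : j.hom ≫ hf.gal.cosetFst H = L.map (quotProj hf H) ≫ r.hom := relToCoset_cosetFst hf H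
  have h₂ : j.hom ≫ hf.gal.cosetMul H = L.map (quotAct hf H) ≫ r.hom := relToCoset_cosetMul hf H
  constructor
  · rintro ⟨Q, q, w⟩
    have hw : IsExactFork (hf.gal.cosetFst H) (hf.gal.cosetMul H) q := w
    let i : Q ≅ L.obj (L.objPreimage Q) := (L.objObjPreimageIso Q).symm
    obtain ⟨q', hq'⟩ := L.map_surjective (r.hom ≫ q ≫ i.hom)
    refine ⟨_, q', (isExactFork_map_iff L _ _ _).1 (hw.of_iso j.symm r.symm i ?_ ?_ ?_)⟩
    · rw [Iso.symm_hom, Iso.symm_hom, Iso.inv_comp_eq, ← Category.assoc, h₁, Category.assoc,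
        Iso.hom_inv_id, Category.comp_id]
    · rw [Iso.symm_hom, Iso.symm_hom, Iso.inv_comp_eq, ← Category.assoc, h₂, Category.assoc,
        Iso.hom_inv_id, Category.comp_id]
    · rw [hq']
      exact (r.inv_hom_id_assoc (q ≫ i.hom)).symm
  · rintro ⟨Q, q, hq⟩
    exact ⟨L.obj Q, r.inv ≫ L.map q, ((isExactFork_map_iff L _ _ _).2 hq).of_iso j r (Iso.refl _)
      h₁ h₂ (by simp)⟩

end Coset

/-! ### Quotients of `X` and their kernel pairs -/

section Kernel

variable {A : Type u₁} [Category.{v₁} A] {B : Type u₂} [Category.{v₂} B] {S : A ⥤ B} {C : B ⥤ A}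
  [HasPullbacks A]

/-- The inclusion `X ×_P X ⟶ X ×_Y X` of kernel pairs, for `f = h ≫ p` with `h : X ⟶ P`. -/
def kerIncl {X Y : A} {f : X ⟶ Y} {a : Over Y} (h : X ⟶ a.left) (w : h ≫ a.hom = f) :
    pullback h h ⟶ pullback f f :=
  pullback.lift (pullback.fst h h) (pullback.snd h h) (by rw [← w, pullback.condition_assoc])

variable {X Y : A} {f : X ⟶ Y} {a : Over Y} (h : X ⟶ a.left) (w : h ≫ a.hom = f)

theorem kerIncl_fst : kerIncl h w ≫ pullback.fst f f = pullback.fst h h := pullback.lift_fst _ _ _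

theorem kerIncl_snd : kerIncl h w ≫ pullback.snd f f = pullback.snd h h := pullback.lift_snd _ _ _

instance mono_kerIncl : Mono (kerIncl h w) where
  right_cancellation u v e := by
    apply pullback.hom_ext
    · rw [← kerIncl_fst h w, reassoc_of% e]
    · rw [← kerIncl_snd h w, reassoc_of% e]

/-- The inclusion `X ×_P X ⟶ X ×_Y X` over `X`, with respect to the second projections. -/
def kerInclOver : (Over.pullback h).obj (Over.mk h) ⟶ (Over.pullback f).obj (Over.mk f) :=
  Over.homMk (kerIncl h w) (kerIncl_snd h w)

variable {adj : S ⊣ C}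

/-- A quotient `h : X ⟶ P` over `Y`, with `P` split by `f`, is split by itself: `X ×_P X` is the
equaliser of the two morphisms `(x, y) ↦ (h x, y)` and `(x, y) ↦ (h y, y)` from `X ×_Y X` to
`P ×_Y X`, both of which are local over `X`. -/
theorem isSplit_self (w : h ≫ a.hom = f) (hc : IsIso (sliceAdj adj X).counit)
    (hf : IsSplit adj f (Over.mk f)) (ha : IsSplit adj f a) : IsSplit adj h (Over.mk h) := by
  let d := (Over.pullback h).obj (Over.mk h)
  let e := (Over.pullback f).obj (Over.mk f)
  let k : d ⟶ e := kerInclOver h w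
  let c : e ⟶ (Over.pullback f).obj a := (Over.pullback f).map (Over.homMk h w)
  let R := (sliceC adj X).obj ((sliceS S X).obj d)
  let η : d ⟶ R := (sliceAdj adj X).unit.app d
  -- the extension of `k` along the unit
  obtain ⟨ρ, hρ⟩ : ∃ ρ : R ⟶ e, η ≫ ρ = k := by
    have : IsIso ((sliceAdj adj X).unit.app e) := hf
    refine ⟨(sliceC adj X).map ((sliceS S X).map k) ≫ inv ((sliceAdj adj X).unit.app e), ?_⟩
    rw [← Category.assoc, IsIso.comp_inv_eq]
    exact (sliceAdj adj X).unit_naturality k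
  have hβ : (R.hom ≫ h) ≫ a.hom = R.hom ≫ f := by rw [Category.assoc, w]
  let β : R ⟶ (Over.pullback f).obj a :=
    Over.homMk (pullback.lift (R.hom ≫ h) R.hom hβ) (pullback.lift_snd _ _ _)
  have hβ₁ : β.left ≫ pullback.fst a.hom f = R.hom ≫ h := pullback.lift_fst _ _ _
  have hc₁ : c.left ≫ pullback.fst a.hom f = pullback.fst f f ≫ h := pullback.lift_fst _ _ _
  have key : ρ ≫ c = β := by
    refine hom_ext_unit (sliceAdj adj X) hc ha ?_
    change η ≫ ρ ≫ c = η ≫ β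
    rw [← Category.assoc, hρ]
    ext
    refine pullback.hom_ext (f := a.hom) (g := f) ?_ ?_
    · rw [Over.comp_left, Over.comp_left, Category.assoc, Category.assoc, hβ₁, hc₁,
        Over.w_assoc]
      exact ((reassoc_of% @kerIncl_fst) h w h).trans pullback.condition
    · exact (Over.w (k ≫ c)).trans (Over.w (η ≫ β)).symm
  have hr : (ρ.left ≫ pullback.fst f f) ≫ h = R.hom ≫ h := by
    rw [← hβ₁, ← key, Over.comp_left, Category.assoc, Category.assoc, hc₁]
  let r : R ⟶ d := Over.homMk (pullback.lift (ρ.left ≫ pullback.fst f f) R.hom hr)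
    (pullback.lift_snd _ _ _)
  refine isIso_unit_of_retraction (sliceAdj adj X) hc r ?_
  change η ≫ r = 𝟙 d
  ext
  refine pullback.hom_ext (f := h) (g := h) ?_ ?_
  · have h₁ : r.left ≫ pullback.fst h h = ρ.left ≫ pullback.fst f f := pullback.lift_fst _ _ _
    have h₂ : η.left ≫ ρ.left = k.left := congrArg CommaMorphism.left hρ
    refine (Category.assoc _ _ _).trans ((congrArg (η.left ≫ ·) h₁).trans ?_)
    refine (Category.assoc _ _ _).symm.trans ((congrArg (· ≫ pullback.fst f f) h₂).trans ?_)
    exact (kerIncl_fst h w).trans (Category.id_comp _).symm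
  · exact (Over.w (η ≫ r)).trans (Category.id_comp _).symm

theorem mono_galIncl [HasPullbacks B] (w : h ≫ a.hom = f) (hc : IsIso (sliceAdj adj X).counit)
    (hf : IsSplit adj f (Over.mk f)) (ha : IsSplit adj f a) :
    Mono (galIncl S h a.hom f w) := by
  have hk : Mono (kerInclOver h w) := by
    have : Mono ((Over.forget X).map (kerInclOver h w)) := mono_kerIncl h w
    exact (Over.forget X).mono_of_mono_map this
  have hm : Mono ((sliceS S X).map (kerInclOver h w)) :=
    mono_map_of_isIso_unit (sliceAdj adj X) hc (isSplit_self h w hc hf ha) hf (kerInclOver h w)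
  exact inferInstanceAs (Mono ((Over.forget _).map ((sliceS S X).map (kerInclOver h w))))

end Kernel

section Correspondence

open InternalGroupoid

variable {A : Type u₁} [Category.{v₁} A] {B : Type u₂} [Category.{v₂} B] {S : A ⥤ B} {C : B ⥤ A}
  [HasPullbacks A] [HasPullbacks B]

variable {adj : S ⊣ C} {X Y : A} {f : X ⟶ Y} (hf : IsRelativeGaloisDescent adj f)

/-- The inclusion of Galois groupoids `S(X ×_P X) ⟶ S(X ×_Y X)` is `S` of a morphism of kernel pair
groupoids. -/
theorem isHom_galIncl {a : Over Y} (h : X ⟶ a.left) (w : h ≫ a.hom = f)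
    (hs : IsSplit adj h (Over.mk h)) :
    IsHom (galGroupoid adj h hf.counit_iso hs) hf.gal (galIncl S h a.hom f w) where
  src := (galMap_src hf (kerIncl h w)).trans (congrArg S.map (kerIncl_fst h w))
  tgt := (galMap_tgt hf (kerIncl h w)).trans (congrArg S.map (kerIncl_snd h w))
  one := by
    refine (map_galMap hf (pullback.diagonal h) (kerIncl h w)).trans (congrArg (galMap hf) ?_)
    apply pullback.hom_ext
    · rw [Category.assoc, kerIncl_fst, pullback.diagonal_fst, pullback.diagonal_fst]
    · rw [Category.assoc, kerIncl_snd, pullback.diagonal_snd, pullback.diagonal_snd]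
  comp {T} u v huv huv' := by
    have h₂ := gal_isPullback_two adj h hf.counit_iso hs
    let α := pullback.fst (pullback.snd h h) (pullback.fst h h)
    let β := pullback.snd (pullback.snd h h) (pullback.fst h h)
    have hαβ : α ≫ pullback.snd h h = β ≫ pullback.fst h h := pullback.condition
    have hαβ' : (α ≫ kerIncl h w) ≫ pullback.snd f f = (β ≫ kerIncl h w) ≫ pullback.fst f f := by
      rw [Category.assoc, Category.assoc, kerIncl_fst, kerIncl_snd, hαβ]
    obtain ⟨t, hu, hv⟩ : ∃ t, u = t ≫ S.map α ∧ v = t ≫ S.map β :=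
      ⟨h₂.lift u v huv, (h₂.lift_fst _ _ _).symm, (h₂.lift_snd _ _ _).symm⟩
    have e₁ : (galGroupoid adj h hf.counit_iso hs).mul u v huv = t ≫ S.map (kerComp h α β hαβ) :=
      galComp_spec adj h hf.counit_iso hs t α β hαβ hu hv huv
    have e₂ : hf.gal.mul (u ≫ galIncl S h a.hom f w) (v ≫ galIncl S h a.hom f w) huv' =
        t ≫ galMap hf (kerComp f (α ≫ kerIncl h w) (β ≫ kerIncl h w) hαβ') := by
      refine mul_galMap hf t _ _ hαβ' ?_ ?_ _
      · rw [hu, ← map_galMap]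
        exact Category.assoc _ _ _
      · rw [hv, ← map_galMap]
        exact Category.assoc _ _ _
    refine Eq.trans ?_ e₂.symm
    refine (congrArg (· ≫ galIncl S h a.hom f w) e₁).trans ?_
    refine (Category.assoc _ _ _).trans (congrArg (t ≫ ·) ?_)
    refine (map_galMap hf _ (kerIncl h w)).trans (congrArg (galMap hf) ?_)
    apply pullback.hom_ext
    · rw [Category.assoc, kerIncl_fst, pullback.lift_fst, pullback.lift_fst, Category.assoc,
        kerIncl_fst]
    · rw [Category.assoc, kerIncl_snd, pullback.lift_snd, pullback.lift_snd, Category.assoc,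
        kerIncl_snd]

/-- The image of a monomorphism of groupoids that is the identity on objects is a subgroupoid. -/
theorem isSubgroupoid_mk {G₀ : B} (G K : InternalGroupoid G₀) (i : K.arr ⟶ G.arr) [Mono i]
    (hi : IsHom K G i) (hinv : K.inv ≫ i = i ≫ G.inv) : G.IsSubgroupoid (Subobject.mk i) where
  one := Subobject.mk_factors_iff i _ |>.2 ⟨K.one, hi.one⟩
  inv := Subobject.mk_factors_iff i _ |>.2 ⟨(Subobject.underlyingIso i).hom ≫ K.inv, by
    change (_ ≫ _) ≫ i = _
    rw [Category.assoc, hinv, ← Category.assoc, Subobject.underlyingIso_hom_comp_eq_mk]⟩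
  mul a b h ha hb := by
    obtain ⟨a', rfl⟩ : ∃ a' : _ ⟶ K.arr, a' ≫ i = a := (Subobject.mk_factors_iff i _).1 ha
    obtain ⟨b', rfl⟩ : ∃ b' : _ ⟶ K.arr, b' ≫ i = b := (Subobject.mk_factors_iff i _).1 hb
    have h' : a' ≫ K.tgt = b' ≫ K.src := by
      rw [← hi.src, ← hi.tgt, ← Category.assoc, ← Category.assoc]
      exact h
    exact (Subobject.mk_factors_iff i _).2 ⟨K.mul a' b' h', hi.comp a' b' h' h⟩

/-- `X ×_{S(X)} H ⟶ X ×_Y X` represents the morphisms whose image under `S` factors through `H`. -/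
theorem exists_hom_relObj (H : Subobject hf.gal.arr) {d : Over X}
    (k : d ⟶ (Over.pullback f).obj (Over.mk f)) (hk : H.Factors (galMap hf k.left)) :
    ∃ θ : d ⟶ relObj hf H, θ.left ≫ relToKer hf H = k.left := by
  have hσ := H.factorThru_arrow _ hk
  have w : (H.factorThru _ hk ≫ (relIso hf H).inv) ≫ S.map (relObj hf H).hom = S.map d.hom := by
    rw [← relIso_hom_comp, Category.assoc, Iso.inv_hom_id_assoc, ← Category.assoc, hσ]
    exact (galMap_tgt hf k.left).trans (congrArg S.map (Over.w k))
  obtain ⟨θ, hθ⟩ := (isLocal_relObj hf H).exists_hom _ w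
  refine ⟨θ, congrArg CommaMorphism.left (IsLocal.hom_ext
    (e := (Over.pullback f).obj (Over.mk f)) hf.selfSplit (u := θ ≫ quotRelToKer hf H) (v := k) ?_)⟩
  refine (map_galMap hf θ.left (relToKer hf H)).symm.trans ?_
  rw [hθ, galMap_relToKer, Category.assoc, Iso.inv_hom_id_assoc, hσ]
  rfl

/-- `X ×_{S(X)} H ⟶ X ×_Y X` is a monomorphism over `X`, because its source is local and `S` sends
it to the inclusion of `H`. -/
instance mono_quotRelToKer (H : Subobject hf.gal.arr) : Mono (quotRelToKer hf H) where
  right_cancellation {d} u v h := by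
    have h' : S.map u.left ≫ galMap hf (relToKer hf H) =
        S.map v.left ≫ galMap hf (relToKer hf H) := by
      rw [map_galMap, map_galMap]
      exact congrArg (fun k => galMap hf k.left) h
    refine (isLocal_relObj hf H).hom_ext ?_
    rw [← cancel_mono (relIso hf H).hom, ← cancel_mono H.arrow, Category.assoc, Category.assoc,
      ← galMap_relToKer, h']

theorem quotRel_hom_ext {H : Subobject hf.gal.arr} {Z : Split adj f} {u v : Z ⟶ quotRel hf H}
    (h₁ : u ≫ quotAct hf H = v ≫ quotAct hf H) (h₂ : u ≫ quotProj hf H = v ≫ quotProj hf H) :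
    u = v := by
  have e₁ : u.hom.left ≫ (quotAct hf H).hom.left = v.hom.left ≫ (quotAct hf H).hom.left :=
    congrArg (fun k => k.hom.left) h₁
  have e₂ : u.hom.left ≫ (quotProj hf H).hom.left = v.hom.left ≫ (quotProj hf H).hom.left :=
    congrArg (fun k => k.hom.left) h₂
  let d : Over X := Over.mk (v.hom.left ≫ (relObj hf H).hom)
  let u' : d ⟶ relObj hf H := Over.homMk u.hom.left e₂
  let v' : d ⟶ relObj hf H := Over.homMk v.hom.left rfl
  have h : u' ≫ quotRelToKer hf H = v' ≫ quotRelToKer hf H := by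
    ext
    change u.hom.left ≫ relToKer hf H = v.hom.left ≫ relToKer hf H
    rw [quotAct_left] at e₁
    rw [quotProj_left] at e₂
    apply pullback.hom_ext
    · exact (Category.assoc _ _ _).trans (e₁.trans (Category.assoc _ _ _).symm)
    · exact (Category.assoc _ _ _).trans (e₂.trans (Category.assoc _ _ _).symm)
  have h' : u' = v' := (cancel_mono _).1 h
  exact ObjectProperty.hom_ext _ (Over.OverMorphism.ext (congrArg Over.Hom.left h' :))

/-- Elements of `X ×_{S(X)} H` in `Split_Y(f)` are the pairs `(u, v)` of elements of `X` such that
`S` sends `(u, v)` to an arrow in `H`. -/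
theorem exists_hom_quotRel (H : Subobject hf.gal.arr) {Z : Split adj f} (u v : Z ⟶ hf.top)
    (k : Z.obj.left ⟶ pullback f f) (hu : k ≫ pullback.fst f f = u.hom.left)
    (hv : k ≫ pullback.snd f f = v.hom.left) (hk : H.Factors (galMap hf k)) :
    ∃ m : Z ⟶ quotRel hf H, m ≫ quotAct hf H = u ∧ m ≫ quotProj hf H = v := by
  let k' : Over.mk v.hom.left ⟶ (Over.pullback f).obj (Over.mk f) := Over.homMk k hv
  obtain ⟨θ, hθ⟩ := exists_hom_relObj hf H k' hk
  have hθ' : θ.left ≫ relToKer hf H = k := hθ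
  have hw : θ.left ≫ (quotRel hf H).obj.hom = Z.obj.hom := by
    refine Eq.trans ?_ (Over.w v.hom)
    refine (Category.assoc _ _ _).symm.trans ?_
    exact congrArg (· ≫ f) (Over.w θ)
  refine ⟨ObjectProperty.homMk (Over.homMk θ.left hw), ?_, ?_⟩
  · refine ObjectProperty.hom_ext _ (Over.OverMorphism.ext ?_)
    refine Eq.trans ?_ hu
    change θ.left ≫ (quotAct hf H).hom.left = _
    rw [quotAct_left, ← hθ']
    exact (Category.assoc _ _ _).symm
  · refine ObjectProperty.hom_ext _ (Over.OverMorphism.ext ?_)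
    exact Over.w θ

/-- Conversely, the pair given by a morphism to `X ×_{S(X)} H` is sent by `S` to an arrow in `H`. -/
theorem factors_galMap_relToKer (H : Subobject hf.gal.arr) {Z : A} (t : Z ⟶ (relObj hf H).left) :
    H.Factors (galMap hf (t ≫ relToKer hf H)) := by
  rw [← map_galMap, galMap_relToKer, ← Category.assoc]
  exact H.factors_comp_arrow _

theorem le_of_factors_relToKer {H H' : Subobject hf.gal.arr}
    (h : H'.Factors (galMap hf (relToKer hf H))) : H ≤ H' := by
  rw [galMap_relToKer] at h
  have h' : H'.Factors ((relIso hf H).inv ≫ (relIso hf H).hom ≫ H.arrow) :=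
    Subobject.factors_of_factors_right _ h
  rw [Iso.inv_hom_id_assoc] at h'
  exact Subobject.le_of_comm (H'.factorThru _ h') (H'.factorThru_arrow _ h')

theorem le_of_quotRel_hom {H H' : Subobject hf.gal.arr} (m : quotRel hf H ⟶ quotRel hf H')
    (h₁ : m ≫ quotAct hf H' = quotAct hf H) (h₂ : m ≫ quotProj hf H' = quotProj hf H) :
    H ≤ H' := by
  have e₁ : m.hom.left ≫ (quotAct hf H').hom.left = (quotAct hf H).hom.left :=
    congrArg (fun k => k.hom.left) h₁
  have e₂ : m.hom.left ≫ (quotProj hf H').hom.left = (quotProj hf H).hom.left :=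
    congrArg (fun k => k.hom.left) h₂
  rw [quotAct_left, quotAct_left] at e₁
  rw [quotProj_left, quotProj_left] at e₂
  obtain ⟨t, ht⟩ : ∃ t : (relObj hf H).left ⟶ (relObj hf H').left, t = m.hom.left := ⟨_, rfl⟩
  rw [← ht] at e₁ e₂
  have e : t ≫ relToKer hf H' = relToKer hf H := by
    apply pullback.hom_ext
    · exact (Category.assoc _ _ _).trans e₁
    · exact (Category.assoc _ _ _).trans e₂
  refine le_of_factors_relToKer hf ?_
  rw [← e]
  exact factors_galMap_relToKer hf H' t

end Correspondence

/-! ### The order anti-isomorphism -/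

section SplitQuo

variable {A : Type u₁} [Category.{v₁} A] {B : Type u₂} [Category.{v₂} B] {S : A ⥤ B} {C : B ⥤ A}
  [HasPullbacks A] {adj : S ⊣ C} {X Y : A} {f : X ⟶ Y} {hf : IsRelativeGaloisDescent adj f}

namespace SplitQuo

theorem le_iff (P P' : SplitQuo hf) : P ≤ P' ↔ ∃ g : P'.obj ⟶ P.obj, P'.proj ≫ g = P.proj :=
  ⟨fun h => ⟨(Subobject.ofLE P.1 P'.1 h).unop, congrArg Quiver.Hom.unop (Subobject.ofLE_arrow h)⟩,
    fun ⟨g, hg⟩ => Subobject.le_of_comm g.op (congrArg Quiver.Hom.op hg)⟩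

/-- Every regular epimorphism out of `X` in `Split_Y(f)` represents a quotient. -/
theorem exists_iso_proj {Q : Split adj f} (q : hf.top ⟶ Q) (hq : IsRegularEpi q) :
    ∃ (P : SplitQuo hf) (r : Q ≅ P.obj), q ≫ r.hom = P.proj := by
  have : Epi q := inferInstance
  let i := Subobject.underlyingIso q.op
  have hi : i.hom ≫ q.op = (Subobject.mk q.op).arrow := Subobject.underlyingIso_hom_comp_eq_mk q.op
  have hi' : q ≫ i.hom.unop = (Subobject.mk q.op).arrow.unop := congrArg Quiver.Hom.unop hi
  have hr : IsRegularEpi (Subobject.mk q.op).arrow.unop := by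
    obtain ⟨⟨W, a, b, w, hc⟩⟩ := hq
    have hw : a ≫ (Subobject.mk q.op).arrow.unop = b ≫ (Subobject.mk q.op).arrow.unop := by
      rw [← hi', reassoc_of% w]
    exact ⟨⟨⟨W, a, b, hw, IsColimit.ofIsoColimit hc (Cofork.ext i.unop hi')⟩⟩⟩
  exact ⟨⟨Subobject.mk q.op, hr⟩, i.unop, hi'⟩

end SplitQuo

end SplitQuo

section Correspondence

open InternalGroupoid

variable {A : Type u₁} [Category.{v₁} A] {B : Type u₂} [Category.{v₂} B] {S : A ⥤ B} {C : B ⥤ A}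
  [HasPullbacks A] [HasPullbacks B]

variable {adj : S ⊣ C} {X Y : A} {f : X ⟶ Y} {hf : IsRelativeGaloisDescent adj f}

namespace SplitQuo

theorem isSplit_map (P : SplitQuo hf) : IsSplit adj P.map (Over.mk P.map) :=
  isSplit_self P.map P.map_comp hf.counit_iso hf.selfSplit P.obj.property

theorem mono_galIncl (P : SplitQuo hf) : Mono (galIncl S P.map P.obj.obj.hom f P.map_comp) :=
  GaloisCorr.mono_galIncl P.map P.map_comp hf.counit_iso hf.selfSplit P.obj.property

/-- The subgroupoid `Gal[X ⟶ P]` of `Gal[f]` associated with a quotient `P` of `X`. -/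
def galSub (P : SplitQuo hf) : Subobject hf.gal.arr :=
  @Subobject.mk _ _ hf.gal.arr _ (galIncl S P.map P.obj.obj.hom f P.map_comp) P.mono_galIncl

theorem isSubgroupoid_galSub (P : SplitQuo hf) : hf.gal.IsSubgroupoid P.galSub :=
  @isSubgroupoid_mk _ _ _ _ hf.gal (galGroupoid adj P.map hf.counit_iso P.isSplit_map)
    (galIncl S P.map P.obj.obj.hom f P.map_comp) P.mono_galIncl
    (isHom_galIncl hf P.map P.map_comp P.isSplit_map) (by
      refine (S.map_comp _ _).symm.trans (Eq.trans (congrArg S.map ?_) (S.map_comp _ _))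
      apply pullback.hom_ext <;> simp [pullback.lift_fst, pullback.lift_snd])

theorem galSub_factors_iff (P : SplitQuo hf) {T : B} (g : T ⟶ hf.gal.arr) :
    P.galSub.Factors g ↔ ∃ l : T ⟶ S.obj (pullback P.map P.map),
      l ≫ galIncl S P.map P.obj.obj.hom f P.map_comp = g :=
  @Subobject.mk_factors_iff _ _ _ _ _ (galIncl S P.map P.obj.obj.hom f P.map_comp)
    P.mono_galIncl g

/-- A morphism `k` to `X ×_Y X` is sent by `S` to an arrow in `Gal[X ⟶ P]` exactly when its
components are identified by `X ⟶ P`. -/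
theorem factors_galMap_iff (P : SplitQuo hf) {Z : A} (k : Z ⟶ pullback f f) :
    P.galSub.Factors (galMap hf k) ↔
      (k ≫ pullback.fst f f) ≫ P.map = (k ≫ pullback.snd f f) ≫ P.map := by
  rw [galSub_factors_iff]
  constructor
  · rintro ⟨g, hg⟩
    let d : Over X := Over.mk (k ≫ pullback.snd f f)
    let k' : d ⟶ (Over.pullback f).obj (Over.mk f) := Over.homMk k rfl
    have hw : g ≫ S.map (pullback.snd P.map P.map) = S.map d.hom := by
      refine Eq.trans ?_ (galMap_tgt hf k)
      rw [← hg, ← kerIncl_snd P.map P.map_comp, S.map_comp]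
      exact (Category.assoc _ _ _).symm
    obtain ⟨u, hu⟩ := IsLocal.exists_hom (d := d)
      (e := (Over.pullback P.map).obj (Over.mk P.map)) P.isSplit_map g hw
    have hk : u ≫ kerInclOver P.map P.map_comp = k' := by
      refine IsLocal.hom_ext (e := (Over.pullback f).obj (Over.mk f)) hf.selfSplit ?_
      refine Eq.trans ?_ hg
      rw [← hu]
      exact S.map_comp _ _
    have hk' : u.left ≫ kerIncl P.map P.map_comp = k := congrArg CommaMorphism.left hk
    rw [← hk', Category.assoc, Category.assoc, Category.assoc, Category.assoc,
      reassoc_of% @kerIncl_fst, reassoc_of% @kerIncl_snd, pullback.condition]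
  · intro h
    refine ⟨S.map (pullback.lift _ _ h), ?_⟩
    refine (S.map_comp _ _).symm.trans (congrArg S.map ?_)
    apply pullback.hom_ext <;> simp [pullback.lift_fst, pullback.lift_snd]

/-- A quotient `P` coequalises `X ×_{S(X)} H ⇉ X` exactly when `H` is contained in `Gal[X ⟶ P]`. -/
theorem quot_condition_iff (P : SplitQuo hf) (H : Subobject hf.gal.arr) :
    quotAct hf H ≫ P.proj = quotProj hf H ≫ P.proj ↔ H ≤ P.galSub := by
  have e : quotAct hf H ≫ P.proj = quotProj hf H ≫ P.proj ↔
      (relToKer hf H ≫ pullback.fst f f) ≫ P.map = (relToKer hf H ≫ pullback.snd f f) ≫ P.map := by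
    rw [← quotAct_left, ← quotProj_left]
    exact ⟨fun h => congrArg (fun k => k.hom.left) h,
      fun h => ObjectProperty.hom_ext _ (Over.OverMorphism.ext h)⟩
  rw [e, ← P.factors_galMap_iff]
  refine ⟨le_of_factors_relToKer hf, fun h => Subobject.factors_of_le _ h ?_⟩
  rw [galMap_relToKer]
  exact H.factors_comp_arrow _

/-- The kernel pair of `X ⟶ P` in `Split_Y(f)` is `X ×_{S(X)} S(X ×_P X) ⇉ X`. -/
theorem isKernelPair_proj (P : SplitQuo hf) :
    IsKernelPair P.proj (quotProj hf P.galSub) (quotAct hf P.galSub) := by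
  have w := (P.quot_condition_iff P.galSub).2 le_rfl
  have h (s : PullbackCone P.proj P.proj) : ∃ m : s.pt ⟶ quotRel hf P.galSub,
      m ≫ quotAct hf P.galSub = s.snd ∧ m ≫ quotProj hf P.galSub = s.fst := by
    have hs : s.snd.hom.left ≫ P.map = s.fst.hom.left ≫ P.map :=
      congrArg (fun k => k.hom.left) s.condition.symm
    have hY : s.snd.hom.left ≫ f = s.fst.hom.left ≫ f :=
      (Over.w s.snd.hom).trans (Over.w s.fst.hom).symm
    obtain ⟨k, e₁, e₂⟩ : ∃ k : s.pt.obj.left ⟶ pullback f f,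
        k ≫ pullback.fst f f = s.snd.hom.left ∧ k ≫ pullback.snd f f = s.fst.hom.left :=
      ⟨pullback.lift _ _ hY, pullback.lift_fst _ _ _, pullback.lift_snd _ _ _⟩
    refine exists_hom_quotRel hf P.galSub s.snd s.fst k e₁ e₂ ?_
    rw [P.factors_galMap_iff, e₁, e₂]
    exact hs
  choose m h₁ h₂ using h
  exact ⟨⟨w.symm⟩, ⟨PullbackCone.IsLimit.mk _ m h₂ h₁ fun s l e₂ e₁ =>
    quotRel_hom_ext hf (e₁.trans (h₁ s).symm) (e₂.trans (h₂ s).symm)⟩⟩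

theorem isExactFork_proj (P : SplitQuo hf) :
    IsExactFork (quotProj hf P.galSub) (quotAct hf P.galSub) P.proj := by
  have : IsRegularEpi P.proj := P.2
  exact ⟨P.isKernelPair_proj.w, ⟨P.isKernelPair_proj.toCoequalizer'⟩, P.isKernelPair_proj⟩

theorem isQuotientBy_galSub (P : SplitQuo hf) : IsQuotientBy hf P.galSub P := by
  have : IsRegularEpi P.proj := P.2
  have hk := IsPullback.flip P.isKernelPair_proj
  exact ⟨hk.w, ⟨IsKernelPair.toCoequalizer' hk⟩⟩

/-- The effective subgroupoid `Gal[X ⟶ P]` of `Gal[f]`. -/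
def galEff (P : SplitQuo hf) : hf.gal.EffSub :=
  ⟨P.galSub, P.isSubgroupoid_galSub, (isEffective_iff hf _).2 ⟨_, _, P.isExactFork_proj⟩⟩

theorem galSub_le_galSub_iff (P P' : SplitQuo hf) : P'.galSub ≤ P.galSub ↔ P ≤ P' := by
  rw [← P.quot_condition_iff, le_iff]
  constructor
  · intro h
    have : IsRegularEpi P'.proj := P'.2
    exact IsRegularEpi.exists_of_isKernelPair P'.proj P'.isKernelPair_proj P.proj h.symm
  · rintro ⟨g, hg⟩
    rw [← hg, reassoc_of% (P'.quot_condition_iff P'.galSub).2 le_rfl]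

/-- An effective `H` is `Gal[X ⟶ P]` for the coequaliser `X ⟶ P` of `X ×_{S(X)} H ⇉ X`: both are the
kernel pair of `X ⟶ P`. -/
theorem exists_galSub_eq {H : Subobject hf.gal.arr} (hH : hf.gal.IsEffective H) :
    ∃ P : SplitQuo hf, P.galSub = H := by
  obtain ⟨Q, q, w, ⟨hc⟩, hk⟩ := (isEffective_iff hf H).1 hH
  obtain ⟨P, r, hr⟩ := exists_iso_proj q ⟨⟨⟨_, _, _, w, hc⟩⟩⟩
  refine ⟨P, le_antisymm ?_ ((P.quot_condition_iff H).1 ?_)⟩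
  · have hw : quotProj hf P.galSub ≫ q = quotAct hf P.galSub ≫ q := by
      rw [← cancel_mono r.hom, Category.assoc, Category.assoc, hr, P.isKernelPair_proj.w]
    exact le_of_quotRel_hom hf (hk.lift _ _ hw) (hk.lift_snd _ _ hw) (hk.lift_fst _ _ hw)
  · rw [← hr, reassoc_of% w]

end SplitQuo

/-- The order anti-isomorphism between split quotients of `f` and effective subgroupoids of
`Gal[f]`. -/
def galoisCorrespondence (hf : IsRelativeGaloisDescent adj f) : (SplitQuo hf)ᵒᵈ ≃o hf.gal.EffSub :=
  RelIso.ofSurjective (OrderEmbedding.ofMapLEIff (fun P => (OrderDual.ofDual P).galEff)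
    fun P P' => SplitQuo.galSub_le_galSub_iff (OrderDual.ofDual P') (OrderDual.ofDual P))
    fun H => (SplitQuo.exists_galSub_eq H.2.2).imp fun _ h => Subtype.ext h

end Correspondence

end

end GaloisCorr

theorem theorem3p2 {A : Type u₁} [Category.{v₁} A] [HasPullbacks A]
    {B : Type u₂} [Category.{v₂} B] [HasPullbacks B]
    {S : A ⥤ B} {C : B ⥤ A} (adj : S ⊣ C) {X Y : A} (f : X ⟶ Y)
    (hf : IsRelativeGaloisDescent adj f) :
    ∃ Φ : (SplitQuo hf)ᵒᵈ ≃o hf.gal.EffSub,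
      (∀ P : SplitQuo hf,
        ∃ (hs : IsSplit adj P.map (Over.mk P.map))
          (_ : Mono (galIncl S P.map P.obj.obj.hom f P.map_comp)),
          InternalGroupoid.IsHom (galGroupoid adj P.map hf.counit_iso hs) hf.gal
            (galIncl S P.map P.obj.obj.hom f P.map_comp) ∧
          (Φ (OrderDual.toDual P)).1 =
            Subobject.mk (galIncl S P.map P.obj.obj.hom f P.map_comp)) ∧
      (∀ G' : hf.gal.EffSub, IsQuotientBy hf G'.1 (OrderDual.ofDual (Φ.symm G'))) := by
  refine ⟨galoisCorrespondence hf, fun P => ⟨P.isSplit_map, P.mono_galIncl,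
    isHom_galIncl hf P.map P.map_comp P.isSplit_map, rfl⟩, fun G' => ?_⟩
  have h : (OrderDual.ofDual ((galoisCorrespondence hf).symm G')).galSub = G'.1 :=
    congrArg Subtype.val ((galoisCorrespondence hf).apply_symm_apply G')
  have h' := (OrderDual.ofDual ((galoisCorrespondence hf).symm G')).isQuotientBy_galSub
  rwa [h] at h'
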